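/- Let $(X,\mathcal B,\mu,T)$ be an invertible measure-preserving system on a non-atomic standard Borel probability space, and let $A=(t_n)_{n\ge 1}$ be a strictly increasing sequence of non-negative integers. For a finite measurable partition $\xi=\{X_1,\dots,X_m\}$ put $H(\xi)=-\sum_i\mu(X_i)\log\mu(X_i)$ (with $0\log 0=0$), and define the sequence entropy of $T$ along $A$ by \[h^A(T)=\sup_{\xi}\,h^A(T,\xi),\qquad h^A(T,\xi)=\limsup_{n\to\infty}\frac1n H\Big(\bigvee_{k=1}^n T^{-t_k}\xi\Big),\] the supremum being over all finite measurable partitions $\xi$ of $X$. The system is called a rank one system if there are integers $q_n\ge 2$ $(n\ge 0)$ and $a_{n,i}\ge 0$ $(n\ge0,\ 1\le i\le q_n-1)$ such that, with $a_n=\sum_{i=1}^{q_n-1}a_{n,i}$, $h_0=1$ and $h_{n+1}=q_nh_n+a_n$, the series $\sum_n a_n/h_{n+1}$ converges, and measurable sets $F_n$, $F_{n,i}$ $(1\le i\le q_n)$ and $C_{n,i,j}$ $(1\le i\le q_n-1,\ 1\le j\le a_{n,i})$ such that for every $n\ge 0$: (a) $F_n,TF_n,\dots,T^{h_n-1}F_n$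 are pairwise disjoint; (b) $F_n$ is the disjoint union of $F_{n,1},\dots,F_{n,q_n}$; (c) for $1\le i\le q_n-1$, $T^{h_n}F_{n,i}$ equals $C_{n,i,1}$ if $a_{n,i}>0$ and $F_{n,i+1}$ if $a_{n,i}=0$; (d) for $1\le i\le q_n-1$, $TC_{n,i,j}=C_{n,i,j+1}$ for $1\le j<a_{n,i}$, and $TC_{n,i,a_{n,i}}=F_{n,i+1}$ if $a_{n,i}>0$; (e) $F_{n+1}=F_{n,1}$; and such that the partitions $\xi_n=\{F_n,TF_n,\dots,T^{h_n-1}F_n,\ X\setminus\bigcup_{k<h_n}T^kF_n\}$ approach the point partition, i.e. for every $B\in\mathcal B$ and $\varepsilon>0$, for all sufficiently large $n$ there is a union $U$ of atoms of $\xi_n$ with $\mu(B\triangle U)<\varepsilon$. **Theorem.** Let $\beta>0$ and let $A=(t_n)_{n\ge1}$ with $t_n=\lfloor n^\alpha\rfloor$, where $\alpha=1+1/\beta$. (i) For every real $m>0$ there is a rank one system $(X,\mathcal B,\mu,T)$ with $0<h^A(T)<m$. (ii) For every integer $L\ge 2$ there is a rank one system $(X,\mathcal B,\mu,T)$ with \[C_1\log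 L\le h^A(T)\le C_2\log L,\qquad C_1=\frac{\beta}{1+\beta},\quad C_2=(2\beta)^{\frac1{1+\beta}}.\] -/

import Mathlib

open MeasureTheory Filter

noncomputable section

namespace SeqEnt

/-! ### Sequence entropy -/

/-- Shannon entropy `∑ i, f (μ (X_i))`, `f x = -x log x`, of the finite partition
`X_i = φ ⁻¹' {i}` given by its coding function `φ : X → ι`. -/
def shannonEntropy {X : Type*} [MeasurableSpace X] (μ : Measure X) {ι : Type*} [Fintype ι]
    (φ : X → ι) : ℝ :=
  ∑ i : ι, Real.negMulLog (μ.real (φ ⁻¹' {i}))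

/-- The sequence coding map `x ↦ φ (T^{t_1} x) ⋯ φ (T^{t_n} x)`; it is the coding function of the
join `⋁_{k=1}^n T^{-t_k} ξ` when `φ` is that of `ξ`. -/
def seqCoding {X : Type*} (T : X → X) (t : ℕ → ℕ) {ι : Type*} (φ : X → ι) (n : ℕ) (x : X) :
    Fin n → ι :=
  fun k => φ (T^[t (k + 1)] x)

/-- `h^A(T, ξ) = limsup_n (1/n) H(⋁_{k=1}^n T^{-t_k} ξ)`, where `A = (t_n)_{n ≥ 1}` and `ξ` is the
finite partition with coding function `φ`. -/
def seqEntropyOf {X : Type*} [MeasurableSpace X] (μ : Measure X) (T : X → X) (t : ℕ → ℕ)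
    {ι : Type*} [Fintype ι] (φ : X → ι) : EReal :=
  limsup (fun n : ℕ => ((1 / (n : ℝ) * shannonEntropy μ (seqCoding T t φ n) : ℝ) : EReal)) atTop

/-- `h^A(T)`, the supremum of `h^A(T, ξ)` over all finite measurable partitions `ξ` of `X`. -/
def seqEntropy {X : Type*} [MeasurableSpace X] (μ : Measure X) (T : X → X) (t : ℕ → ℕ) : EReal :=
  ⨆ (m : ℕ) (φ : X → Fin m) (_ : Measurable φ), seqEntropyOf μ T t φ

/-! ### Rank one systems (constructive geometric definition) -/

/-- `a_n = ∑_{i=1}^{q_n - 1} a_{n,i}`. -/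
def spacerCount (q : ℕ → ℕ) (a : ℕ → ℕ → ℕ) (n : ℕ) : ℕ :=
  ∑ i ∈ Finset.Ico 1 (q n), a n i

/-- The tower heights `h_0 = 1`, `h_{n+1} = q_n h_n + a_n`. -/
def height (q : ℕ → ℕ) (a : ℕ → ℕ → ℕ) : ℕ → ℕ
  | 0 => 1
  | n + 1 => q n * height q a n + spacerCount q a n

/-- The partition `{F, TF, …, T^{h-1}F, X ∖ ⋃_{k<h} T^k F}` induced by a tower. -/
def towerPartition {X : Type*} (T : X → X) (F : Set X) (h : ℕ) : Set (Set X) :=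
  {A | ∃ k < h, A = T^[k] '' F} ∪ {(⋃ k < h, T^[k] '' F)ᶜ}

/-- The partitions `ξ n` approach the point partition: every measurable set is approximated in
measure by unions of atoms of `ξ n`, for all large `n`. -/
def ApproachesPoints {X : Type*} [MeasurableSpace X] (μ : Measure X) (ξ : ℕ → Set (Set X)) :
    Prop :=
  ∀ B : Set X, MeasurableSet B → ∀ ε : ENNReal, 0 < ε →
    ∃ N : ℕ, ∀ n ≥ N, ∃ J ⊆ ξ n, μ (symmDiff B (⋃₀ J)) < ε

/-- `T` is obtained by cutting and stacking: at step `n` the tower with base `F n` and height `h_n`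
is cut into the `q n` columns over `Fs n i` (`1 ≤ i ≤ q n`), and `a n i` spacer levels
`C n i j` (`1 ≤ j ≤ a n i`) are put on top of the `i`-th column for `1 ≤ i < q n`. -/
structure IsCutAndStack {X : Type*} [MeasurableSpace X] (μ : Measure X) (T : X → X)
    (q : ℕ → ℕ) (a : ℕ → ℕ → ℕ) (F : ℕ → Set X) (Fs : ℕ → ℕ → Set X)
    (C : ℕ → ℕ → ℕ → Set X) : Prop where
  two_le_q : ∀ n, 2 ≤ q n
  summable_spacers :
    Summable fun n => (spacerCount q a n : ℝ) / (height q a (n + 1) : ℝ)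
  measurable_F : ∀ n, MeasurableSet (F n)
  measurable_Fs : ∀ n i, 1 ≤ i → i ≤ q n → MeasurableSet (Fs n i)
  measurable_C : ∀ n i j, 1 ≤ i → i < q n → 1 ≤ j → j ≤ a n i → MeasurableSet (C n i j)
  levels_disjoint : ∀ n k l, k < height q a n → l < height q a n → k ≠ l →
    Disjoint (T^[k] '' F n) (T^[l] '' F n)
  columns_disjoint : ∀ n i j, 1 ≤ i → i ≤ q n → 1 ≤ j → j ≤ q n → i ≠ j →
    Disjoint (Fs n i) (Fs n j)
  columns_cover : ∀ n, F n = ⋃ i ∈ Finset.Icc 1 (q n), Fs n i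
  top_to_spacer : ∀ n i, 1 ≤ i → i < q n → 0 < a n i →
    T^[height q a n] '' Fs n i = C n i 1
  top_to_next : ∀ n i, 1 ≤ i → i < q n → a n i = 0 →
    T^[height q a n] '' Fs n i = Fs n (i + 1)
  spacer_to_spacer : ∀ n i j, 1 ≤ i → i < q n → 1 ≤ j → j < a n i →
    T '' C n i j = C n i (j + 1)
  spacer_to_next : ∀ n i, 1 ≤ i → i < q n → 0 < a n i →
    T '' C n i (a n i) = Fs n (i + 1)
  next_base : ∀ n, F (n + 1) = Fs n 1
  generating : ApproachesPoints μ fun n => towerPartition T (F n) (height q a n)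

/-- `(X, μ, T)` is a rank one system: `μ` is a non-atomic (points are null) probability measure on a standard Borel
space, the invertible map `T` preserves `μ`, and `T` is obtained by cutting and stacking. -/
structure IsRankOneSystem {X : Type*} [MeasurableSpace X] (μ : Measure X) (T : X ≃ᵐ X) :
    Prop where
  standardBorel : StandardBorelSpace X
  isProbabilityMeasure : IsProbabilityMeasure μ
  nullSingleton : NullSingletonClass μ
  measurePreserving : MeasurePreserving T μ μ
  cutAndStack : ∃ q a F Fs C, IsCutAndStack μ T q a F Fs C

end SeqEnt

end

/-! The construction realizes every value `C * log L` with `0 < C ≤ 1 / α = β / (1 + β)` exactly.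
Part (i) takes `L = 2` and `C` small; part (ii) takes `C = β / (1 + β)` and uses `β / (1 + β) ≤ (2 *
β) ^ (1 / (1 + β))`.

The system is a skyscraper over the 2-adic odometer. A tower of height `h` is cut into about `K * L
^ K` columns, with `K = ⌈C * (C * h) ^ β⌉`, and the numbers of spacers, all less than `L`, run
through the concatenation of all words of length `K` over `{0, …, L - 1}`. A random list of `K`
successive spacer numbers is then nearly uniform, so its entropy is about `K * log L`
(`le_shannonEntropy_window`).

Lower bound. Observe at the first `N ≈ (C * h) ^ β` times. Since `t_N ≈ N * N ^ (1 / β)`, the orbit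
passes about `C * N ≈ K` towers, and successive observations are about `α * C * h ≤ h` apart, so at
most one tower is left between two of them. The level in a fixed low tower then reveals how many
spacers were passed, except near the ends of that tower, which is rare. Hence the names carry almost
all of the entropy `K * log L` (`decode`, `shannonEntropy_window_le`).

Upper bound. Any partition is close to one into levels of a fixed tower. Given `N`, let `h` be the
first tower height with `N ≤ (C * h) ^ β` and `h'` the height before it. The starting level in the
tower and the next `t_N / h + O(1)` spacer numbers determine the name. The first costs `log h ≈ C *
(C * h') ^ β * log L`, the second `N * (N ^ (1 / β) / h) * log L`; each is at most about `C * N *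
log L`. They are not large together: either `N ^ (1 / β)` is small compared with `h`, and the second
is negligible, or `N` is comparable with `h ^ β`, and `log h` is `o(N)`
(`HasRate.eventually_exists_tower`). -/

noncomputable section

namespace SeqEnt

/-! ### Shannon entropy of finite partitions -/

section Entropy

variable {X : Type*} [MeasurableSpace X] {μ : Measure X}
  {ι κ : Type*}

theorem sum_measureReal_preimage [Fintype ι] [IsProbabilityMeasure μ] {φ : X → ι}
    (hφ : ∀ i, MeasurableSet (φ ⁻¹' {i})) : ∑ i, μ.real (φ ⁻¹' {i}) = 1 := by
  have h := measureReal_biUnion_finset (μ := μ) (s := Finset.univ) (f := fun i => φ ⁻¹' {i})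
    (by
      intro i _ j _ hij
      exact Disjoint.preimage _ (by simpa using hij)) (fun i _ => hφ i)
  have hu : (⋃ b ∈ (Finset.univ : Finset ι), φ ⁻¹' {b}) = Set.univ := by
    ext x; simp
  rw [hu] at h
  simpa using h.symm

theorem measureReal_preimage_comp [Fintype ι] [IsFiniteMeasure μ] {φ : X → ι} [DecidableEq κ]
    (hφ : ∀ i, MeasurableSet (φ ⁻¹' {i})) (f : ι → κ) (k : κ) :
    μ.real ((f ∘ φ) ⁻¹' {k}) = ∑ i with f i = k, μ.real (φ ⁻¹' {i}) := by
  rw [← measureReal_biUnion_finset]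
  · congr 1
    ext x; simp
  · intro i _ j _ hij
    exact Disjoint.preimage _ (by simpa using hij)
  · exact fun i _ => hφ i

theorem negMulLog_sum_le {s : Finset ι} {p : ι → ℝ} (hp : ∀ i ∈ s, 0 ≤ p i) :
    Real.negMulLog (∑ i ∈ s, p i) ≤ ∑ i ∈ s, Real.negMulLog (p i) := by
  have h1 : Real.negMulLog (∑ i ∈ s, p i) = ∑ i ∈ s, -(p i * Real.log (∑ i ∈ s, p i)) := by
    rw [Real.negMulLog, neg_mul, Finset.sum_mul, Finset.sum_neg_distrib]
  rw [h1]
  refine Finset.sum_le_sum fun i hi => ?_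
  rw [Real.negMulLog, neg_mul]
  rcases (hp i hi).eq_or_lt with h0 | h0
  · simp [← h0]
  · have : Real.log (p i) ≤ Real.log (∑ i ∈ s, p i) :=
      Real.log_le_log h0 (Finset.single_le_sum hp hi)
    nlinarith

theorem shannonEntropy_comp_le [Fintype ι] [Fintype κ] [IsFiniteMeasure μ] {φ : X → ι}
    (hφ : ∀ i, MeasurableSet (φ ⁻¹' {i})) (f : ι → κ) :
    shannonEntropy μ (f ∘ φ) ≤ shannonEntropy μ φ := by
  classical
  unfold shannonEntropy
  simp_rw [measureReal_preimage_comp hφ f]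
  refine (Finset.sum_le_sum fun k _ => negMulLog_sum_le fun i _ => measureReal_nonneg).trans ?_
  exact (Finset.sum_fiberwise Finset.univ f fun i => Real.negMulLog (μ.real (φ ⁻¹' {i}))).le

/-- If `ψ` separates every pair of points separated by `φ`, then `φ` has at most the entropy
of `ψ`. -/
theorem shannonEntropy_le_of_factor [Fintype ι] [Fintype κ] [IsFiniteMeasure μ] {φ : X → κ} {ψ : X → ι}
    (hψ : ∀ i, MeasurableSet (ψ ⁻¹' {i})) (h : ∀ x y, ψ x = ψ y → φ x = φ y) :
    shannonEntropy μ φ ≤ shannonEntropy μ ψ := by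
  rcases isEmpty_or_nonempty X with hX | ⟨⟨x₀⟩⟩
  · have h0 : ∀ s : Set X, s = ∅ := fun s => Set.eq_empty_of_isEmpty s
    simp [shannonEntropy, h0 (φ ⁻¹' _), h0 (ψ ⁻¹' _)]
  · have : φ = (Function.extend ψ φ fun _ => φ x₀) ∘ ψ := by
      funext x
      exact (Function.FactorsThrough.extend_apply (fun a b hab => h a b hab) _ x).symm
    rw [this]
    exact shannonEntropy_comp_le hψ _

theorem shannonEntropy_le_log_card [Fintype ι] [IsProbabilityMeasure μ] {φ : X → ι}
    (hφ : ∀ i, MeasurableSet (φ ⁻¹' {i})) :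
    shannonEntropy μ φ ≤ Real.log (Fintype.card ι) := by
  have hs := sum_measureReal_preimage (μ := μ) hφ
  set p := fun i => μ.real (φ ⁻¹' {i}) with hp
  have hcard : 0 < (Fintype.card ι : ℝ) := by
    rcases isEmpty_or_nonempty ι with h | h
    · simp at hs
    · exact_mod_cast Fintype.card_pos
  have key : ∀ i, Real.negMulLog (p i) ≤
      p i * Real.log (Fintype.card ι) + 1 / Fintype.card ι - p i := by
    intro i
    have h0 : 0 ≤ p i := measureReal_nonneg
    rcases h0.eq_or_lt with h | h
    · simp [← h]
    -- Gibbs' inequality against the uniform distribution; the linear error terms cancel on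
    -- summation.
    · have := Real.log_le_sub_one_of_pos (x := 1 / (Fintype.card ι * p i)) (by positivity)
      rw [one_div, Real.log_inv, Real.log_mul hcard.ne' h.ne'] at this
      have h2 := mul_le_mul_of_nonneg_left this h0
      have h3 : p i * ((Fintype.card ι * p i)⁻¹ - 1) = 1 / Fintype.card ι - p i := by
        field_simp
      rw [Real.negMulLog]
      linarith
  calc shannonEntropy μ φ = ∑ i, Real.negMulLog (p i) := rfl
    _ ≤ ∑ i, (p i * Real.log (Fintype.card ι) + 1 / Fintype.card ι - p i) :=
        Finset.sum_le_sum fun i _ => key i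
    _ = Real.log (Fintype.card ι) := by
        rw [Finset.sum_sub_distrib, Finset.sum_add_distrib, ← Finset.sum_mul, hs]
        simp
        field_simp
        ring

/-- Entropy dominates min-entropy. Lower bounds on the entropy of spacer lists thus only need a
bound on the largest atom. -/
theorem neg_log_le_shannonEntropy [Fintype ι] [IsProbabilityMeasure μ] {φ : X → ι}
    (hφ : ∀ i, MeasurableSet (φ ⁻¹' {i})) {m : ℝ} (hm : ∀ i, μ.real (φ ⁻¹' {i}) ≤ m) :
    -Real.log m ≤ shannonEntropy μ φ := by
  have hs := sum_measureReal_preimage (μ := μ) hφ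
  calc -Real.log m = ∑ i, μ.real (φ ⁻¹' {i}) * (-Real.log m) := by
        rw [← Finset.sum_mul, hs, one_mul]
    _ ≤ shannonEntropy μ φ := by
        refine Finset.sum_le_sum fun i _ => ?_
        have h0 : 0 ≤ μ.real (φ ⁻¹' {i}) := measureReal_nonneg
        rcases h0.eq_or_lt with h | h
        · simp [← h]
        · have := Real.log_le_log h (hm i)
          rw [Real.negMulLog]
          nlinarith

/-- Gibbs' inequality for the joint distribution `r` against the product `p * q` of its marginals.
-/
theorem shannonEntropy_prod_le [Fintype ι] [Fintype κ] [IsProbabilityMeasure μ] {φ : X → ι} {ψ : X → κ}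
    (hφ : ∀ i, MeasurableSet (φ ⁻¹' {i})) (hψ : ∀ i, MeasurableSet (ψ ⁻¹' {i})) :
    shannonEntropy μ (fun x => (φ x, ψ x)) ≤ shannonEntropy μ φ + shannonEntropy μ ψ := by
  classical
  have hset : ∀ i k, (fun x => (φ x, ψ x)) ⁻¹' {(i, k)} = φ ⁻¹' {i} ∩ ψ ⁻¹' {k} := by
    intro i k; ext x; simp
  set P := fun x => (φ x, ψ x) with hP
  have hPm : ∀ ik, MeasurableSet (P ⁻¹' {ik}) := fun ⟨i, k⟩ => by
    rw [hset]; exact (hφ i).inter (hψ k)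
  set p := fun i => μ.real (φ ⁻¹' {i})
  set q := fun k => μ.real (ψ ⁻¹' {k})
  set r := fun i k => μ.real (P ⁻¹' {(i, k)})
  have hp1 : ∑ i, p i = 1 := sum_measureReal_preimage hφ
  have hq1 : ∑ k, q k = 1 := sum_measureReal_preimage hψ
  have hr1 : ∑ i, ∑ k, r i k = 1 := by
    rw [← Fintype.sum_prod_type']
    exact sum_measureReal_preimage hPm
  have hrp : ∀ i, ∑ k, r i k = p i := by
    intro i
    have := measureReal_preimage_comp (μ := μ) hPm Prod.fst i
    have h2 : (Prod.fst ∘ P) = φ := rfl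
    rw [h2] at this
    simp only [p]
    rw [this]
    refine (Finset.sum_bij (fun k _ => (i, k)) ?_ ?_ ?_ ?_)
    · simp
    · simp
    · rintro ⟨a, b⟩ h
      simp at h
      exact ⟨b, by simp [h]⟩
    · intros; rfl
  have hrq : ∀ k, ∑ i, r i k = q k := by
    intro k
    have := measureReal_preimage_comp (μ := μ) hPm Prod.snd k
    have h2 : (Prod.snd ∘ P) = ψ := rfl
    rw [h2] at this
    simp only [q]
    rw [this]
    refine (Finset.sum_bij (fun i _ => (i, k)) ?_ ?_ ?_ ?_)
    · simp
    · simp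
    · rintro ⟨a, b⟩ h
      simp at h
      exact ⟨a, by simp [h]⟩
    · intros; rfl
  have key : ∀ i k, Real.negMulLog (r i k) ≤
      -(r i k * Real.log (p i)) - r i k * Real.log (q k) + p i * q k - r i k := by
    intro i k
    have h0 : 0 ≤ r i k := measureReal_nonneg
    have hp0 : 0 ≤ p i := measureReal_nonneg
    have hq0 : 0 ≤ q k := measureReal_nonneg
    rcases h0.eq_or_lt with h | h
    · rw [← h]; simp; positivity
    · have hp : 0 < p i := h.trans_le
        ((Finset.single_le_sum (f := fun k => r i k) (fun _ _ => measureReal_nonneg)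
          (Finset.mem_univ k)).trans (hrp i).le)
      have hq : 0 < q k := h.trans_le
        ((Finset.single_le_sum (f := fun i => r i k) (fun _ _ => measureReal_nonneg)
          (Finset.mem_univ i)).trans (hrq k).le)
      have := Real.log_le_sub_one_of_pos (x := p i * q k / r i k) (by positivity)
      rw [Real.log_div (by positivity) h.ne', Real.log_mul hp.ne' hq.ne'] at this
      have h2 := mul_le_mul_of_nonneg_left this h0
      have h3 : r i k * (p i * q k / r i k - 1) = p i * q k - r i k := by
        field_simp
      rw [Real.negMulLog]
      linarith
  have e1 : ∑ i, ∑ k, -(r i k * Real.log (p i)) = shannonEntropy μ φ := by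
    unfold shannonEntropy
    refine Finset.sum_congr rfl fun i _ => ?_
    rw [Finset.sum_neg_distrib, ← Finset.sum_mul, hrp, Real.negMulLog, neg_mul]
  have e2 : ∑ i, ∑ k, r i k * Real.log (q k) = -shannonEntropy μ ψ := by
    rw [Finset.sum_comm]
    unfold shannonEntropy
    rw [← Finset.sum_neg_distrib]
    refine Finset.sum_congr rfl fun k _ => ?_
    rw [← Finset.sum_mul, hrq, Real.negMulLog, neg_mul, neg_neg]
  have e3 : ∑ i, ∑ k, p i * q k = 1 := by
    simp_rw [← Finset.mul_sum, hq1, mul_one, hp1]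
  calc shannonEntropy μ P = ∑ i, ∑ k, Real.negMulLog (r i k) := by
        unfold shannonEntropy
        rw [← Fintype.sum_prod_type']
    _ ≤ ∑ i, ∑ k, (-(r i k * Real.log (p i)) - r i k * Real.log (q k) + p i * q k - r i k) :=
        Finset.sum_le_sum fun i _ => Finset.sum_le_sum fun k _ => key i k
    _ = _ := by
        simp_rw [Finset.sum_sub_distrib, Finset.sum_add_distrib, Finset.sum_sub_distrib]
        rw [e1, e2, e3, hr1]; ring

theorem measurableSet_preimage_pi {N : ℕ} {φ : X → Fin N → ι}
    (hφ : ∀ k i, MeasurableSet ((fun x => φ x k) ⁻¹' {i})) (v : Fin N → ι) :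
    MeasurableSet (φ ⁻¹' {v}) := by
  have : φ ⁻¹' {v} = ⋂ k, (fun x => φ x k) ⁻¹' {v k} := by
    ext x; simp [funext_iff]
  rw [this]
  exact MeasurableSet.iInter fun k => hφ k _

theorem measurableSet_preimage_prodMk {φ : X → ι} {ψ : X → κ}
    (hφ : ∀ i, MeasurableSet (φ ⁻¹' {i})) (hψ : ∀ i, MeasurableSet (ψ ⁻¹' {i})) (v : ι × κ) :
    MeasurableSet ((fun x => (φ x, ψ x)) ⁻¹' {v}) := by
  have : (fun x => (φ x, ψ x)) ⁻¹' {v} = φ ⁻¹' {v.1} ∩ ψ ⁻¹' {v.2} := by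
    ext x; simp [Prod.ext_iff]
  rw [this]
  exact (hφ _).inter (hψ _)

theorem shannonEntropy_pi_le [Fintype ι] [IsProbabilityMeasure μ] {N : ℕ} {φ : X → Fin N → ι}
    (hφ : ∀ k i, MeasurableSet ((fun x => φ x k) ⁻¹' {i})) :
    shannonEntropy μ φ ≤ ∑ k, shannonEntropy μ (fun x => φ x k) := by
  induction N with
  | zero =>
    simpa using shannonEntropy_le_log_card (μ := μ) (measurableSet_preimage_pi hφ)
  | succ N ih =>
    have hm : ∀ v, MeasurableSet ((fun x (k : Fin N) => φ x k.succ) ⁻¹' {v}) :=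
      measurableSet_preimage_pi fun k i => hφ k.succ i
    calc shannonEntropy μ φ
        ≤ shannonEntropy μ (fun x => (φ x 0, fun k : Fin N => φ x k.succ)) := by
          refine shannonEntropy_le_of_factor
            (measurableSet_preimage_prodMk (hφ 0) hm) fun x y h => ?_
          simp only [Prod.mk.injEq, funext_iff] at h
          funext k
          refine Fin.cases h.1 h.2 k
      _ ≤ _ := shannonEntropy_prod_le (hφ 0) hm
      _ ≤ _ := by
          rw [Fin.sum_univ_succ]
          gcongr
          exact ih fun k i => hφ k.succ i

theorem shannonEntropy_comp_measurePreserving [Fintype ι] {Y : Type*} [MeasurableSpace Y] {ν : Measure Y}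
    {T : X → Y} (hT : MeasurePreserving T μ ν) {φ : Y → ι}
    (hφ : ∀ i, MeasurableSet (φ ⁻¹' {i})) :
    shannonEntropy μ (fun x => φ (T x)) = shannonEntropy ν φ := by
  unfold shannonEntropy
  refine Finset.sum_congr rfl fun i _ => ?_
  rw [← hT.measureReal_preimage (hφ i).nullMeasurableSet]
  rfl

/-- A partition with one atom of measure close to `1` has small entropy. -/
theorem exists_shannonEntropy_le (ι : Type*) [Fintype ι] {ε : ℝ} (hε : 0 < ε) :
    ∃ δ > 0, ∀ {X : Type*} [MeasurableSpace X] (μ : Measure X) [IsProbabilityMeasure μ]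
      (φ : X → ι) (i₀ : ι), (∀ i, MeasurableSet (φ ⁻¹' {i})) →
      μ.real {x | φ x ≠ i₀} ≤ δ → shannonEntropy μ φ ≤ ε := by
  have hc : 0 < (Fintype.card ι : ℝ) + 1 := by positivity
  set e := ε / (Fintype.card ι + 1) with he
  have he0 : 0 < e := by positivity
  have h0 : ∀ᶠ p in nhds (0 : ℝ), Real.negMulLog p < e :=
    (Real.continuous_negMulLog.tendsto 0).eventually_lt_const (by simpa using he0)
  have h1 : ∀ᶠ p in nhds (1 : ℝ), Real.negMulLog p < e :=
    (Real.continuous_negMulLog.tendsto 1).eventually_lt_const (by simpa using he0)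
  obtain ⟨d0, hd0, h0⟩ := Metric.eventually_nhds_iff.1 h0
  obtain ⟨d1, hd1, h1⟩ := Metric.eventually_nhds_iff.1 h1
  -- The atom of `i₀` has measure near `1` and all the others near `0`, and `negMulLog` is small
  -- near both points.
  refine ⟨min d0 d1 / 2, by positivity, fun {X} _ μ _ φ i₀ hφ hδ => ?_⟩
  have hlt : min d0 d1 / 2 < min d0 d1 := half_lt_self (by positivity)
  have key : ∀ i, Real.negMulLog (μ.real (φ ⁻¹' {i})) ≤ e := by
    intro i
    by_cases hi : i = i₀
    · have hc : μ.real (φ ⁻¹' {i₀}) = 1 - μ.real {x | φ x ≠ i₀} := by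
        have := probReal_compl_eq_one_sub (μ := μ) (hφ i₀)
        have h2 : (φ ⁻¹' {i₀})ᶜ = {x | φ x ≠ i₀} := by ext; simp
        rw [h2] at this
        linarith
      refine (h1 ?_).le
      rw [hi, hc, Real.dist_eq, abs_lt]
      have : 0 ≤ μ.real {x | φ x ≠ i₀} := measureReal_nonneg
      constructor <;> linarith [min_le_right d0 d1]
    · refine (h0 ?_).le
      have hsub : μ.real (φ ⁻¹' {i}) ≤ μ.real {x | φ x ≠ i₀} :=
        measureReal_mono fun x hx => by
          simp only [Set.mem_preimage, Set.mem_singleton_iff] at hx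
          simpa [hx] using hi
      have : 0 ≤ μ.real (φ ⁻¹' {i}) := measureReal_nonneg
      rw [Real.dist_eq, abs_lt]
      constructor <;> linarith [min_le_left d0 d1]
  calc shannonEntropy μ φ ≤ ∑ _i : ι, e := Finset.sum_le_sum fun i _ => key i
    _ = Fintype.card ι * e := by simp
    _ ≤ ε := by
      rw [he, mul_div_assoc', div_le_iff₀ hc]
      nlinarith

end Entropy

/-! ### Orbits cut into blocks of variable length, and their decoding -/

section BlockCoding

variable {X : Type*}

/-- A coding of the orbits of `T` by successive blocks: `x` is at offset `o x` of its current block,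
and the current and the following blocks have lengths `h + z x 0, h + z x 1, …`. -/
structure BlockCoding (T : X → X) (h L : ℕ) (o : X → ℕ) (z : X → ℕ → ℕ) : Prop where
  z_lt : ∀ x i, z x i < L
  o_lt : ∀ x, o x < h + z x 0
  step : ∀ x, o x + 1 < h + z x 0 → o (T x) = o x + 1 ∧ z (T x) = z x
  wrap : ∀ x, o x + 1 = h + z x 0 → o (T x) = 0 ∧ z (T x) = fun i => z x (i + 1)

/-- After `t` steps from `x`, exactly `i` blocks have been left. -/
def Crosses (T : X → X) (h : ℕ) (o : X → ℕ) (z : X → ℕ → ℕ) (x : X) (t i : ℕ) : Prop :=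
  (∀ l, z (T^[t] x) l = z x (i + l)) ∧
    o x + t = o (T^[t] x) + ∑ l ∈ Finset.range i, (h + z x l)

namespace BlockCoding

variable {T : X → X} {h L : ℕ} {o : X → ℕ} {z : X → ℕ → ℕ}

theorem exists_crosses (hc : BlockCoding T h L o z) (x : X) (t : ℕ) :
    ∃ i, Crosses T h o z x t i := by
  induction t with
  | zero => exact ⟨0, by simp [Crosses]⟩
  | succ t ih =>
    obtain ⟨i, h1, h2⟩ := ih
    set y := T^[t] x with hy
    have hT : T^[t + 1] x = T y := Function.iterate_succ_apply' T t x
    rcases (Nat.succ_le_of_lt (hc.o_lt y)).lt_or_eq with hlt | heq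
    · obtain ⟨ho, hz⟩ := hc.step y hlt
      refine ⟨i, ?_, ?_⟩
      · rw [hT, hz]; exact h1
      · rw [hT, ho]; omega
    · obtain ⟨ho, hz⟩ := hc.wrap y heq
      refine ⟨i + 1, ?_, ?_⟩
      · intro l
        rw [hT, hz]
        simp only [h1]
        congr 1; omega
      · rw [hT, ho, Finset.sum_range_succ]
        have := h1 0
        simp only [add_zero] at this
        simp only [Nat.succ_eq_add_one] at heq
        omega

theorem _root_.SeqEnt.Crosses.trans {x : X} {s t i j : ℕ} (h1 : Crosses T h o z x s i)
    (h2 : Crosses T h o z (T^[s] x) t j) : Crosses T h o z x (s + t) (i + j) := by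
  have hT : T^[s + t] x = T^[t] (T^[s] x) := by
    rw [add_comm, Function.iterate_add_apply]
  refine ⟨fun l => ?_, ?_⟩
  · rw [hT, h2.1, h1.1, add_assoc]
  · rw [hT, Finset.sum_range_add]
    have h3 := h1.2
    have h4 := h2.2
    simp_rw [h1.1] at h4
    omega

theorem add_lt_of_crosses (hc : BlockCoding T h L o z) {x : X} {t i : ℕ}
    (hx : Crosses T h o z x t i) : o x + t < ∑ l ∈ Finset.range (i + 1), (h + z x l) := by
  rw [hx.2, Finset.sum_range_succ]
  have := hc.o_lt (T^[t] x)
  rw [hx.1, add_zero] at this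
  omega

theorem mul_le_of_crosses {x : X} {t i : ℕ}
    (hx : Crosses T h o z x t i) : i * h ≤ o x + t := by
  rw [hx.2]
  have : ∑ l ∈ Finset.range i, h ≤ ∑ l ∈ Finset.range i, (h + z x l) :=
    Finset.sum_le_sum fun l _ => by omega
  simp at this
  omega

theorem lt_mul_of_crosses (hc : BlockCoding T h L o z) {x : X} {t i : ℕ}
    (hx : Crosses T h o z x t i) : t < (i + 1) * (h + L) := by
  have h1 := hc.add_lt_of_crosses hx
  have : ∑ l ∈ Finset.range (i + 1), (h + z x l) ≤ ∑ l ∈ Finset.range (i + 1), (h + L) :=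
    Finset.sum_le_sum fun l _ => by have := hc.z_lt x l; omega
  simp at this
  omega

/-- If `y` had left a further block, time `t` would exceed the length of `i + 1` blocks common to
both points, whereas `x` is still inside the last of them. -/
theorem crosses_le (hc : BlockCoding T h L o z) {x y : X} {t i j : ℕ}
    (hx : Crosses T h o z x t i) (hy : Crosses T h o z y t j) (ho : o x = o y)
    (hz : ∀ l < i + 1, z x l = z y l) : j ≤ i := by
  by_contra! hij
  have h1 := hc.add_lt_of_crosses hx
  have h2 : ∑ l ∈ Finset.range (i + 1), (h + z x l) = ∑ l ∈ Finset.range (i + 1), (h + z y l) :=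
    Finset.sum_congr rfl fun l hl => by rw [hz l (Finset.mem_range.1 hl)]
  have h3 : ∑ l ∈ Finset.range (i + 1), (h + z y l) ≤ ∑ l ∈ Finset.range j, (h + z y l) :=
    Finset.sum_le_sum_of_subset (Finset.range_subset_range.2 hij)
  have := hy.2
  omega

/-- The offsets up to time `t` are determined by the initial offset and the lengths of sufficiently
many blocks. -/
theorem offset_eq (hc : BlockCoding T h L o z) {x y : X} {t W : ℕ} (ho : o x = o y)
    (hz : ∀ l < W, z x l = z y l) (hW : h + L + t ≤ W * h) :
    o (T^[t] x) = o (T^[t] y) := by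
  have hlt : o x < h + L := (hc.o_lt x).trans (by have := hc.z_lt x 0; omega)
  obtain ⟨i, hi⟩ := hc.exists_crosses x t
  obtain ⟨j, hj⟩ := hc.exists_crosses y t
  -- Each block left takes at least `h` steps, so `hW` ensures that the known lengths are not
  -- exhausted.
  have hiW : i < W := by
    have := mul_le_of_crosses hi
    exact lt_of_mul_lt_mul_right (a := h) (by omega) (Nat.zero_le _)
  have hjW : j < W := by
    have := mul_le_of_crosses hj
    exact lt_of_mul_lt_mul_right (a := h) (by omega) (Nat.zero_le _)
  have hji : j ≤ i := hc.crosses_le hi hj ho fun l hl => hz l (by omega)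
  have hij : i ≤ j := hc.crosses_le hj hi ho.symm fun l hl => (hz l (by omega)).symm
  obtain rfl : i = j := le_antisymm hij hji
  have h1 := hi.2
  have h2 := hj.2
  have h3 : ∑ l ∈ Finset.range i, (h + z x l) = ∑ l ∈ Finset.range i, (h + z y l) :=
    Finset.sum_congr rfl fun l hl => by rw [hz l (by have := Finset.mem_range.1 hl; omega)]
  omega

end BlockCoding

/-- `ψ` is the offset function of a block coding with block height `b` that refines into the
coding with offset function `o` and block height `h`. -/
structure OffsetFactor (h b : ℕ) (o ψ : X → ℕ) : Prop where
  le : ∀ x, ψ x ≤ o x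
  eq_add : ∀ x y d, o x = o y + d → d ≤ ψ x → ψ x = ψ y + d
  top : ∀ x, h ≤ o x → b ≤ ψ x

namespace BlockCoding

variable {T : X → X} {h L : ℕ} {o : X → ℕ} {z : X → ℕ → ℕ}

/-- Going back along the orbit, both offsets decrease by one as long as the coarse one is positive:
a positive coarse offset excludes a wrap of either coding. -/
theorem offsetFactor_of_comp {b : ℕ} {ψ : X → ℕ} {z' : X → ℕ → ℕ} (hT : T.Surjective)
    (hc : BlockCoding T h L o z) (hc' : BlockCoding T b L ψ z') (hle : ∀ x, ψ x ≤ o x)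
    (hcomp : ∀ x y, o x = o y → ψ x = ψ y) (htop : ∀ x, h ≤ o x → b ≤ ψ x) :
    OffsetFactor h b o ψ := by
  refine ⟨hle, fun x y d => ?_, htop⟩
  induction d generalizing x with
  | zero => intro h1 _; exact hcomp x y h1
  | succ d ih =>
    intro h1 h2
    obtain ⟨w, rfl⟩ := hT x
    have e1 : ψ (T w) = ψ w + 1 := by
      rcases (Nat.succ_le_of_lt (hc'.o_lt w)).lt_or_eq with hlt | heq
      · exact (hc'.step w hlt).1
      · have := (hc'.wrap w heq).1
        omega
    have e2 : o (T w) = o w + 1 := by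
      rcases (Nat.succ_le_of_lt (hc.o_lt w)).lt_or_eq with hlt | heq
      · exact (hc.step w hlt).1
      · have := (hc.wrap w heq).1
        have := hle (T w)
        omega
    have := ih w (by omega) (by omega)
    omega

/-- One step of decoding: the offset at the next observation time, and the length of the block that
is left, if any, can be recovered from the coarse offset `ψ` unless the latter is near the ends
of its block. -/
theorem decode_step (hc : BlockCoding T h L o z) {b : ℕ} {ψ : X → ℕ} (hψ : OffsetFactor h b o ψ)
    {x y : X} {g : ℕ} (hg : g ≤ h) (ho : o x = o y) (hobs : ψ (T^[g] x) = ψ (T^[g] y))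
    (hbad : ψ (T^[g] x) < L ∨ b ≤ ψ (T^[g] x) → z x 0 = z y 0) :
    ∃ i, Crosses T h o z x g i ∧ Crosses T h o z y g i ∧ o (T^[g] x) = o (T^[g] y) ∧
      ∀ l < i, z x l = z y l := by
  -- Leaving two blocks takes more than `h` steps, because the second is traversed entirely.
  have hlt2 : ∀ {w : X} {k : ℕ}, Crosses T h o z w g k → k < 2 := by
    intro w k hk
    by_contra! h2
    have h3 : ∑ l ∈ Finset.range 2, (h + z w l) ≤ ∑ l ∈ Finset.range k, (h + z w l) :=
      Finset.sum_le_sum_of_subset (Finset.range_subset_range.2 h2)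
    rw [Finset.sum_range_succ, Finset.sum_range_one] at h3
    have := hk.2
    have := hc.o_lt w
    omega
  -- If only `w` has left its block, then `v` stands on the spacers, where `ψ` is at least `b`;
  -- there the two lengths agree by assumption, which is contradictory.
  have hmixed : ∀ {v w : X}, Crosses T h o z v g 0 → Crosses T h o z w g 1 → o v = o w →
      (b ≤ ψ (T^[g] v) → z v 0 = z w 0) → False := by
    intro v w hv hw hvw hz
    have h1 := hv.2
    have h2 := hw.2
    have h3 := hc.o_lt (T^[g] v)
    rw [hv.1] at h3
    simp only [Finset.range_zero, Finset.sum_empty, Finset.sum_range_one, add_zero] at h1 h2 h3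
    have := hz (hψ.top _ (by omega))
    omega
  obtain ⟨i, hi⟩ := hc.exists_crosses x g
  obtain ⟨j, hj⟩ := hc.exists_crosses y g
  have hi2 := hlt2 hi
  have hj2 := hlt2 hj
  have hij : i = j := by
    interval_cases i <;> interval_cases j
    · rfl
    · exact (hmixed hi hj ho fun hb => hbad (Or.inr hb)).elim
    · exact (hmixed hj hi ho.symm fun hb => (hbad (Or.inr (hobs ▸ hb))).symm).elim
    · rfl
  subst hij
  refine ⟨i, hi, hj, ?_⟩
  have h1 := hi.2
  have h2 := hj.2
  interval_cases i
  · simp only [Finset.range_zero, Finset.sum_empty, add_zero] at h1 h2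
    exact ⟨by omega, by simp⟩
  · simp only [Finset.sum_range_one] at h1 h2
    have hx := hc.z_lt x 0
    have hy := hc.z_lt y 0
    have hz : z x 0 = z y 0 := by
      by_cases hb : ψ (T^[g] x) < L ∨ b ≤ ψ (T^[g] x)
      · exact hbad hb
      -- The two new offsets differ by less than `L ≤ ψ`, so the shift from one to the other stays
      -- inside a coarse block and would show in `ψ`.
      · rw [not_or, not_lt] at hb
        rcases le_total (o (T^[g] y)) (o (T^[g] x)) with hle | hle
        · have := hψ.eq_add (T^[g] x) (T^[g] y) (o (T^[g] x) - o (T^[g] y)) (by omega) (by omega)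
          omega
        · have := hψ.eq_add (T^[g] y) (T^[g] x) (o (T^[g] y) - o (T^[g] x)) (by omega) (by omega)
          omega
    refine ⟨by omega, fun l hl => ?_⟩
    obtain rfl : l = 0 := by omega
    exact hz

/-- The single step is iterated along the observation times: recovering the fine offset at each of
them is what allows the next step to start. -/
theorem decode (hc : BlockCoding T h L o z) {b : ℕ} {ψ : X → ℕ} (hψ : OffsetFactor h b o ψ)
    {x y : X} {t : ℕ → ℕ} (ht0 : t 0 = 0) (hmono : Monotone t) (N : ℕ)
    (hgap : ∀ k < N, t (k + 1) ≤ t k + h) (ho : o x = o y)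
    (hobs : ∀ k < N, ψ (T^[t (k + 1)] x) = ψ (T^[t (k + 1)] y))
    (hbad : ∀ k < N, ψ (T^[t (k + 1)] x) < L ∨ b ≤ ψ (T^[t (k + 1)] x) →
      z (T^[t k] x) 0 = z (T^[t k] y) 0) :
    ∃ i, Crosses T h o z x (t N) i ∧ Crosses T h o z y (t N) i ∧
      o (T^[t N] x) = o (T^[t N] y) ∧ ∀ l < i, z x l = z y l := by
  induction N with
  | zero => exact ⟨0, by simp [Crosses, ht0, ho]⟩
  | succ N ih =>
    obtain ⟨i, hx, hy, hoN, hz⟩ := ih (fun k hk => hgap k (by omega))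
      (fun k hk => hobs k (by omega)) fun k hk => hbad k (by omega)
    have hle : t N ≤ t (N + 1) := hmono (Nat.le_succ N)
    have hsplit : t (N + 1) = t N + (t (N + 1) - t N) := by omega
    have hT : ∀ w : X, T^[t (N + 1)] w = T^[t (N + 1) - t N] (T^[t N] w) := by
      intro w
      rw [← Function.iterate_add_apply]; congr 2; omega
    have h1 := hobs N (Nat.lt_succ_self N)
    have h2 := hbad N (Nat.lt_succ_self N)
    simp only [hT] at h1 h2
    have hg := hgap N (Nat.lt_succ_self N)
    obtain ⟨j, hjx, hjy, hoj, hzj⟩ := hc.decode_step hψ (g := t (N + 1) - t N)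
      (by omega) hoN h1 h2
    refine ⟨i + j, ?_, ?_, ?_, ?_⟩
    · rw [hsplit]; exact hx.trans hjx
    · rw [hsplit]; exact hy.trans hjy
    · rw [hT, hT]; exact hoj
    · intro l hl
      rcases lt_or_ge l i with h' | h'
      · exact hz l h'
      · have := hzj (l - i) (by omega)
        rw [hx.1, hy.1] at this
        rwa [Nat.add_sub_cancel' h'] at this

end BlockCoding

end BlockCoding

/-! ### Digit sequences -/

theorem mod_pow_eq_of_digits_eq {L u v k : ℕ} (h : ∀ p < k, u / L ^ p % L = v / L ^ p % L) :
    u % L ^ k = v % L ^ k := by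
  induction k with
  | zero => simp [Nat.mod_one]
  | succ k ih =>
    rw [Nat.mod_pow_succ, Nat.mod_pow_succ, ih fun p hp => h p (by omega), h k (by omega)]

/-- The sequence obtained by concatenating all words of length `M` over `{0, …, L - 1}`, the `w`-th
word being the base `L` expansion of `w`. -/
def wordSeq (L M i : ℕ) : ℕ := i / M / L ^ (i % M) % L

/-- A window starting at digit `s` of the word `w` shows the digits of `w` from `s` on, followed by
the first `s` digits of `w + 1`. As digits are listed from the lowest, these are `(w + 1) % L ^ s`,
which determines `w % L ^ s`. -/
theorem wordSeq_window_injective {L M c d : ℕ} (hcd : c % M = d % M)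
    (hw : ∀ i < M, wordSeq L M (c + i) = wordSeq L M (d + i)) :
    c / M % L ^ M = d / M % L ^ M := by
  rcases Nat.eq_zero_or_pos M with rfl | hM
  · simp [Nat.mod_one]
  set s := c % M with hs
  have hsM : s < M := Nat.mod_lt _ hM
  have hsplit : ∀ {e : ℕ}, e % M = s → e = M * (e / M) + s := fun {e} he => by
    rw [← he]; exact (Nat.div_add_mod e M).symm
  have hhi : ∀ {e p : ℕ}, e % M = s → p < M - s →
      wordSeq L M (e + p) = e / M / L ^ s / L ^ p % L := by
    intro e p he hp
    unfold wordSeq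
    have hlt : s + p < M := by omega
    have h1 : e + p = (s + p) + M * (e / M) := by have := hsplit he; omega
    rw [h1, Nat.add_mul_div_left _ _ hM, Nat.add_mul_mod_self_left,
      Nat.div_eq_of_lt hlt, Nat.mod_eq_of_lt hlt, zero_add, pow_add,
      ← Nat.div_div_eq_div_mul]
  have hlo : ∀ {e p : ℕ}, e % M = s → p < s →
      wordSeq L M (e + (M - s + p)) = (e / M + 1) / L ^ p % L := by
    intro e p he hp
    unfold wordSeq
    have hlt : p < M := by omega
    have h1 : e + (M - s + p) = p + M * (e / M + 1) := by
      have := hsplit he; rw [mul_add]; omega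
    rw [h1, Nat.add_mul_div_left _ _ hM, Nat.add_mul_mod_self_left,
      Nat.div_eq_of_lt hlt, Nat.mod_eq_of_lt hlt, zero_add]
  have e1 : c / M / L ^ s % L ^ (M - s) = d / M / L ^ s % L ^ (M - s) :=
    mod_pow_eq_of_digits_eq fun p hp => by
      rw [← hhi rfl hp, ← hhi hcd.symm hp]; exact hw p (by omega)
  have e2 : c / M % L ^ s = d / M % L ^ s := by
    have : (c / M + 1) % L ^ s = (d / M + 1) % L ^ s :=
      mod_pow_eq_of_digits_eq fun p hp => by
        rw [← hlo rfl hp, ← hlo hcd.symm hp]; exact hw _ (by omega)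
    exact Nat.ModEq.add_right_cancel' 1 this
  have e3 : L ^ M = L ^ s * L ^ (M - s) := by rw [← pow_add]; congr 1; omega
  rw [e3, Nat.mod_mul, Nat.mod_mul, e1, e2]

/-- Every word of length `M` occurs at most `M * (B / L ^ M + 1)` times in the initial part of
`wordSeq L M`. -/
theorem card_window_le {L M B : ℕ} (hM : 0 < M) (v : ℕ → ℕ) (s : Finset ℕ)
    (hs : ∀ c ∈ s, c < B ∧ ∀ i < M, wordSeq L M (c + i) = v i) :
    s.card ≤ M * (B / (M * L ^ M) + 1) := by
  have : s.card ≤ (Finset.range M ×ˢ Finset.range (B / (M * L ^ M) + 1)).card := by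
    -- Given the phase `c % M`, the window fixes `c / M` modulo `L ^ M`; only the quotient remains
    -- free.
    refine Finset.card_le_card_of_injOn (fun c => (c % M, c / M / L ^ M)) ?_ ?_
    · intro c hc
      have := (hs c hc).1
      simp only [Finset.coe_product, Set.mem_prod, Finset.mem_coe, Finset.mem_range]
      refine ⟨Nat.mod_lt _ hM, ?_⟩
      rw [Nat.div_div_eq_div_mul]
      exact Nat.lt_succ_of_le (Nat.div_le_div_right this.le)
    · intro c hc d hd hcd
      simp only [Prod.mk.injEq] at hcd
      have h1 := wordSeq_window_injective (L := L) hcd.1 fun i hi => by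
        rw [(hs c hc).2 i hi, (hs d hd).2 i hi]
      have h2 : c / M = d / M := by
        rw [← Nat.div_add_mod (c / M) (L ^ M), ← Nat.div_add_mod (d / M) (L ^ M), h1, hcd.2]
      rw [← Nat.div_add_mod c M, ← Nat.div_add_mod d M, h2, hcd.1]
  simpa using this

/-! ### Skyscrapers over a measure-preserving map -/

section Skyscraper

variable {Y : Type*}

/-- The skyscraper with `s y + 1` floors over `y`. -/
abbrev Skyscraper (s : Y → ℕ) : Type _ := {p : Y × ℕ // p.2 ≤ s p.1}

namespace Skyscraper

variable {s : Y → ℕ}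

theorem ext_iff' {x y : Skyscraper s} : x = y ↔ x.1.1 = y.1.1 ∧ x.1.2 = y.1.2 := by
  rw [Subtype.ext_iff, Prod.ext_iff]

/-- Going up one floor, and from the top floor to the ground floor over the next point. -/
def shift (S : Equiv.Perm Y) (s : Y → ℕ) : Equiv.Perm (Skyscraper s) where
  toFun x := if h : x.1.2 < s x.1.1 then ⟨(x.1.1, x.1.2 + 1), h⟩ else ⟨(S x.1.1, 0), Nat.zero_le _⟩
  invFun x := if x.1.2 = 0 then ⟨(S.symm x.1.1, s (S.symm x.1.1)), le_rfl⟩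
    else ⟨(x.1.1, x.1.2 - 1), (Nat.sub_le _ _).trans x.2⟩
  left_inv x := by
    obtain ⟨⟨y, j⟩, hj⟩ := x
    by_cases h : j < s y
    · simp [h]
    · have : j = s y := le_antisymm hj (not_lt.1 h)
      subst this
      simp
  right_inv x := by
    obtain ⟨⟨y, j⟩, hj⟩ := x
    simp only at hj
    by_cases h : j = 0
    · subst h; simp
    · have h1 : j - 1 < s y := by omega
      have h2 : j - 1 + 1 = j := by omega
      simp [h, h1, h2]

theorem shift_apply_of_lt (S : Equiv.Perm Y) {x : Skyscraper s} (h : x.1.2 < s x.1.1) :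
    shift S s x = ⟨(x.1.1, x.1.2 + 1), h⟩ := by
  simp [shift, h]

theorem shift_apply_of_eq (S : Equiv.Perm Y) {x : Skyscraper s} (h : x.1.2 = s x.1.1) :
    shift S s x = ⟨(S x.1.1, 0), Nat.zero_le _⟩ := by
  simp [shift, h]

/-- The section of a subset of the skyscraper at the floor `j`. -/
def floorSection (B : Set (Skyscraper s)) (j : ℕ) : Set Y :=
  {y | ∃ h : j ≤ s y, (⟨(y, j), h⟩ : Skyscraper s) ∈ B}

theorem floorSection_preimage_shift (S : Equiv.Perm Y) (B : Set (Skyscraper s)) (j : ℕ) :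
    floorSection (shift S s ⁻¹' B) j =
      floorSection B (j + 1) ∪ (s ⁻¹' {j} ∩ S ⁻¹' floorSection B 0) := by
  ext y
  constructor
  · rintro ⟨h, hx⟩
    rcases h.lt_or_eq with hlt | heq
    · left
      rw [Set.mem_preimage, shift_apply_of_lt S hlt] at hx
      exact ⟨hlt, hx⟩
    · right
      rw [Set.mem_preimage, shift_apply_of_eq S heq] at hx
      exact ⟨heq.symm, Nat.zero_le _, hx⟩
  · rintro (⟨h, hx⟩ | ⟨h, h0, hx⟩)
    · refine ⟨(Nat.le_succ j).trans h, ?_⟩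
      rw [Set.mem_preimage, shift_apply_of_lt S (by exact h)]
      exact hx
    · have hj : s y = j := h
      refine ⟨hj.ge, ?_⟩
      rw [Set.mem_preimage, shift_apply_of_eq S (by exact hj.symm)]
      exact hx

theorem floorSection_preimage_shift_symm (S : Equiv.Perm Y) (B : Set (Skyscraper s)) (j : ℕ) :
    floorSection ((shift S s).symm ⁻¹' B) j =
      if j = 0 then S.symm ⁻¹' {y | ∃ i, s y = i ∧ y ∈ floorSection B i}
      else floorSection B (j - 1) ∩ {y | j ≤ s y} := by
  ext y
  split_ifs with h
  · subst h
    simp [floorSection, shift]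
  · constructor
    · rintro ⟨h', hx⟩
      simp only [shift, Equiv.coe_fn_symm_mk, Set.mem_preimage, h, if_false] at hx
      exact ⟨⟨_, hx⟩, h'⟩
    · rintro ⟨⟨_, hx⟩, h'⟩
      refine ⟨h', ?_⟩
      simpa only [shift, Equiv.coe_fn_symm_mk, Set.mem_preimage, h, if_false] using hx

variable [MeasurableSpace Y]

/-- The sum over the floors of the measure of the sections. -/
def rawMeasure (ν : Measure Y) (s : Y → ℕ) : Measure (Skyscraper s) :=
  (ν.prod Measure.count).comap Subtype.val

variable {ν : Measure Y}

theorem measurableSet_skyscraper (hs : Measurable s) :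
    MeasurableSet {p : Y × ℕ | p.2 ≤ s p.1} :=
  measurableSet_le measurable_snd (hs.comp measurable_fst)

theorem measurableSet_floorSection (hs : Measurable s) {B : Set (Skyscraper s)}
    (hB : MeasurableSet B) (j : ℕ) : MeasurableSet (floorSection B j) := by
  have h1 : MeasurableSet (Subtype.val '' B : Set (Y × ℕ)) :=
    (measurableSet_skyscraper hs).subtype_image hB
  have h2 : floorSection B j = (fun y => (y, j)) ⁻¹' (Subtype.val '' B) := by
    ext y; simp [floorSection]
  rw [h2]
  exact measurable_prodMk_right h1

theorem rawMeasure_apply [SFinite ν] (hs : Measurable s) {B : Set (Skyscraper s)}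
    (hB : MeasurableSet B) : rawMeasure ν s B = ∑' j, ν (floorSection B j) := by
  have h1 : MeasurableSet (Subtype.val '' B : Set (Y × ℕ)) :=
    (measurableSet_skyscraper hs).subtype_image hB
  have h2 : rawMeasure ν s B = (ν.prod Measure.count) (Subtype.val '' B) :=
    (MeasurableEmbedding.subtype_coe (measurableSet_skyscraper hs)).comap_apply _ _
  rw [h2, Measure.prod_apply_symm h1, lintegral_count]
  refine tsum_congr fun j => ?_
  congr 1
  ext y; simp [floorSection]

theorem measurable_of_floors {Z : Type*} [MeasurableSpace Z]
    {f : Skyscraper s → Z} (hf : ∀ (C : Set Z), MeasurableSet C → ∀ j,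
      MeasurableSet (floorSection (f ⁻¹' C) j)) : Measurable f := by
  intro C hC
  have : f ⁻¹' C = Subtype.val ⁻¹' ⋃ j, floorSection (f ⁻¹' C) j ×ˢ ({j} : Set ℕ) := by
    ext ⟨⟨y, j⟩, h⟩
    simp only [floorSection, Set.mem_preimage, Set.mem_iUnion, Set.mem_prod, Set.mem_ofPred_eq,
      Set.mem_singleton_iff]
    constructor
    · exact fun hx => ⟨j, ⟨h, hx⟩, rfl⟩
    · rintro ⟨i, ⟨_, hx⟩, rfl⟩; exact hx
  rw [this]
  exact measurable_subtype_coe (MeasurableSet.iUnion fun j =>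
    (hf C hC j).prod (measurableSet_singleton j))

/-- The shift of a skyscraper as a measurable equivalence. -/
def measurableShift (S : Y ≃ᵐ Y) (hs : Measurable s) : Skyscraper s ≃ᵐ Skyscraper s where
  toEquiv := shift S.toEquiv s
  measurable_toFun := measurable_of_floors fun C hC j => by
    rw [floorSection_preimage_shift]
    exact (measurableSet_floorSection hs hC _).union ((hs (measurableSet_singleton j)).inter
      (S.measurable (measurableSet_floorSection hs hC 0)))
  measurable_invFun := measurable_of_floors fun C hC j => by
    rw [floorSection_preimage_shift_symm]
    split_ifs
    · refine S.symm.measurable ?_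
      have : {y | ∃ i, s y = i ∧ y ∈ floorSection C i} =
          ⋃ i, s ⁻¹' {i} ∩ floorSection C i := by ext y; simp
      rw [this]
      exact MeasurableSet.iUnion fun i => (hs (measurableSet_singleton i)).inter
        (measurableSet_floorSection hs hC i)
    · exact (measurableSet_floorSection hs hC _).inter
        (measurableSet_le measurable_const hs)

/-- Floor `j` of the preimage consists of floor `j + 1` of the set and, over the points whose top
floor is `j`, of the `S`-preimage of the ground floor. Summed over `j`, the latter parts reassemble
the ground floor. -/
theorem measurePreserving_measurableShift [SFinite ν] {S : Y ≃ᵐ Y} (hS : MeasurePreserving S ν ν)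
    (hs : Measurable s) :
    MeasurePreserving (measurableShift S hs) (rawMeasure ν s) (rawMeasure ν s) := by
  refine ⟨(measurableShift S hs).measurable, ?_⟩
  ext B hB
  rw [Measure.map_apply (measurableShift S hs).measurable hB,
    rawMeasure_apply hs ((measurableShift S hs).measurable hB), rawMeasure_apply hs hB]
  have h0 := measurableSet_floorSection hs hB 0
  have e1 : ∀ j, ν (floorSection (measurableShift S hs ⁻¹' B) j) =
      ν (floorSection B (j + 1)) + ν (s ⁻¹' {j} ∩ S ⁻¹' floorSection B 0) := by
    intro j
    have := floorSection_preimage_shift S.toEquiv B j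
    have h2 : floorSection (measurableShift S hs ⁻¹' B) j =
      floorSection B (j + 1) ∪ (s ⁻¹' {j} ∩ S ⁻¹' floorSection B 0) := this
    rw [h2, measure_union]
    · rw [Set.disjoint_left]
      rintro y ⟨h, _⟩ ⟨h', _⟩
      have : s y = j := h'
      omega
    · exact (hs (measurableSet_singleton j)).inter (S.measurable h0)
  have e2 : ∑' j, ν (s ⁻¹' {j} ∩ S ⁻¹' floorSection B 0) = ν (floorSection B 0) := by
    rw [← hS.measure_preimage h0.nullMeasurableSet, ← measure_iUnion]
    · congr 1
      ext y; simp
    · intro i j hij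
      exact Disjoint.inter_left _ (Disjoint.inter_right _
        (Disjoint.preimage _ (by simpa using hij)))
    · exact fun j => (hs (measurableSet_singleton j)).inter (S.measurable h0)
  simp_rw [e1]
  rw [ENNReal.tsum_add, e2, add_comm]
  exact (tsum_eq_zero_add' (f := fun j => ν (floorSection B j)) ENNReal.summable).symm

theorem rawMeasure_preimage_le [SFinite ν] (hs : Measurable s) {L : ℕ} (hL : ∀ y, s y < L)
    {A : Set Y} (hA : MeasurableSet A) :
    rawMeasure ν s {x | x.1.1 ∈ A} ≤ L * ν A := by
  have hm : MeasurableSet {x : Skyscraper s | x.1.1 ∈ A} :=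
    (measurable_fst.comp measurable_subtype_coe) hA
  rw [rawMeasure_apply hs hm]
  have h0 : ∀ j ∉ Finset.range L, ν (floorSection {x : Skyscraper s | x.1.1 ∈ A} j) = 0 := by
    intro j hj
    have : floorSection {x : Skyscraper s | x.1.1 ∈ A} j = ∅ := by
      ext y
      simp only [floorSection, Set.mem_ofPred_eq, Set.mem_empty_iff_false, iff_false]
      rintro ⟨h, _⟩
      have := hL y
      simp at hj
      omega
    rw [this, measure_empty]
  rw [tsum_eq_sum h0]
  calc _ ≤ ∑ _j ∈ Finset.range L, ν A :=
        Finset.sum_le_sum fun j _ => measure_mono fun y hy => hy.2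
    _ = L * ν A := by simp

theorem measure_univ_le_rawMeasure_univ [SFinite ν] (hs : Measurable s) :
    ν Set.univ ≤ rawMeasure ν s Set.univ := by
  rw [rawMeasure_apply hs MeasurableSet.univ]
  refine le_trans (le_of_eq ?_) (ENNReal.le_tsum 0)
  congr 1
  ext y; simp [floorSection]

/-- The normalized measure on a skyscraper. -/
def probMeasure (ν : Measure Y) (s : Y → ℕ) : Measure (Skyscraper s) :=
  (rawMeasure ν s Set.univ)⁻¹ • rawMeasure ν s

theorem isProbabilityMeasure_probMeasure [IsProbabilityMeasure ν] (hs : Measurable s) {L : ℕ}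
    (hL : ∀ y, s y < L) : IsProbabilityMeasure (probMeasure ν s) := by
  refine ⟨?_⟩
  rw [probMeasure, Measure.smul_apply, smul_eq_mul]
  refine ENNReal.inv_mul_cancel ?_ ?_
  · have := measure_univ_le_rawMeasure_univ (ν := ν) hs
    rw [measure_univ] at this
    exact (zero_lt_one.trans_le this).ne'
  · have := rawMeasure_preimage_le (ν := ν) hs hL MeasurableSet.univ
    simp only [Set.mem_univ, Set.ofPred_true, measure_univ, mul_one] at this
    exact (this.trans_lt (ENNReal.natCast_lt_top L)).ne

theorem measurePreserving_probMeasure [SFinite ν] {S : Y ≃ᵐ Y} (hS : MeasurePreserving S ν ν)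
    (hs : Measurable s) :
    MeasurePreserving (measurableShift S hs) (probMeasure ν s) (probMeasure ν s) :=
  (measurePreserving_measurableShift hS hs).smul_measure _

/-- There are at most `L` floors, and normalizing only decreases the measure because the ground
floor already has mass `1`. -/
theorem probMeasure_preimage_le [IsProbabilityMeasure ν] (hs : Measurable s) {L : ℕ}
    (hL : ∀ y, s y < L) {A : Set Y} (hA : MeasurableSet A) :
    (probMeasure ν s).real {x | x.1.1 ∈ A} ≤ L * ν.real A := by
  have h1 : probMeasure ν s {x | x.1.1 ∈ A} ≤ L * ν A := by
    rw [probMeasure, Measure.smul_apply, smul_eq_mul]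
    refine le_trans ?_ (rawMeasure_preimage_le hs hL hA)
    have : (rawMeasure ν s Set.univ)⁻¹ ≤ 1 := by
      rw [ENNReal.inv_le_one]
      simpa using measure_univ_le_rawMeasure_univ (ν := ν) hs
    exact mul_le_of_le_one_left (zero_le) this
  have h2 := ENNReal.toReal_mono (ENNReal.mul_ne_top (ENNReal.natCast_ne_top L)
    (measure_ne_top ν A)) h1
  simpa [measureReal_def] using h2

end Skyscraper

end Skyscraper

/-! ### Residues of 2-adic integers -/

instance : MeasurableSpace ℤ_[2] := borel _

instance : BorelSpace ℤ_[2] := ⟨rfl⟩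

/-- The residue of a 2-adic integer modulo `2 ^ n`. -/
def res (n : ℕ) (z : ℤ_[2]) : ℕ := (PadicInt.toZModPow n z).val

theorem res_lt (n : ℕ) (z : ℤ_[2]) : res n z < 2 ^ n := ZMod.val_lt _

theorem res_natCast (n m : ℕ) : res n (m : ℤ_[2]) = m % 2 ^ n := by
  rw [res, map_natCast, ZMod.val_natCast]

theorem res_add_natCast (n : ℕ) (z : ℤ_[2]) (m : ℕ) :
    res n (z + m) = (res n z + m) % 2 ^ n := by
  rw [res, map_add, map_natCast, ZMod.val_add, ZMod.val_natCast, Nat.add_mod_mod, res]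

theorem res_mod {m n : ℕ} (h : m ≤ n) (z : ℤ_[2]) : res n z % 2 ^ m = res m z := by
  have h1 := PadicInt.cast_toZModPow m n h z
  rw [res, res, ← h1, ZMod.cast_eq_val, ZMod.val_natCast]

theorem res_sub_res (n : ℕ) (z : ℤ_[2]) : res n (z - (res n z : ℕ)) = 0 := by
  simp [res]

theorem eq_of_res_eq {z w : ℤ_[2]} (h : ∀ N, ∃ n ≥ N, res n z = res n w) : z = w := by
  refine PadicInt.ext_of_toZModPow.1 fun m => ?_
  obtain ⟨n, hn, h⟩ := h m
  refine ZMod.val_injective _ ?_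
  change res m z = res m w
  rw [← res_mod hn, ← res_mod hn, h]

theorem res_eq_iff (n : ℕ) (z w : ℤ_[2]) : res n z = res n w ↔ ‖z - w‖ ≤ (2 : ℝ) ^ (-n : ℤ) := by
  have h1 := PadicInt.norm_le_pow_iff_mem_span_pow (p := 2) (z - w) n
  rw [← PadicInt.ker_toZModPow, RingHom.mem_ker, map_sub, sub_eq_zero] at h1
  rw [Nat.cast_ofNat] at h1
  rw [h1]
  exact (ZMod.val_injective _).eq_iff

theorem measurable_res (n : ℕ) : Measurable (res n) := by
  refine Continuous.measurable ?_
  refine IsLocallyConstant.continuous (IsLocallyConstant.iff_eventually_eq _ |>.2 fun z => ?_)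
  rw [Metric.eventually_nhds_iff]
  refine ⟨(2 : ℝ) ^ (-n : ℤ), by positivity, fun w hw => ?_⟩
  rw [res_eq_iff]
  rw [dist_eq_norm] at hw
  exact hw.le

/-- The Haar probability measure on the 2-adic integers. -/
def haar2 : Measure ℤ_[2] := Measure.addHaarMeasure ⊤

instance : IsProbabilityMeasure haar2 := ⟨Measure.addHaarMeasure_self⟩

/-- The 2-adic odometer. -/
def odometer : ℤ_[2] ≃ᵐ ℤ_[2] := MeasurableEquiv.addRight 1

theorem measurePreserving_odometer : MeasurePreserving odometer haar2 haar2 := by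
  have : Measure.IsAddLeftInvariant haar2 := by unfold haar2; infer_instance
  exact measurePreserving_add_right haar2 1

theorem haar2_res_add (n : ℕ) (m k : ℕ) (hm : m + k < 2 ^ n) :
    haar2.real {z | res n z = m} = haar2.real {z | res n z = m + k} := by
  have : Measure.IsAddLeftInvariant haar2 := by unfold haar2; infer_instance
  have h := (measurePreserving_add_right haar2 (k : ℤ_[2])).measureReal_preimage
    (s := {z | res n z = m + k})
    (measurable_res n (measurableSet_singleton (m + k))).nullMeasurableSet
  rw [← h]
  congr 1
  ext z
  simp only [Set.mem_ofPred_eq, Set.mem_preimage, res_add_natCast]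
  have hz := res_lt n z
  constructor
  · intro h; rw [h, Nat.mod_eq_of_lt hm]
  · intro h
    rcases lt_or_ge (res n z + k) (2 ^ n) with h1 | h1
    · rw [Nat.mod_eq_of_lt h1] at h; omega
    · rw [Nat.mod_eq_sub_mod h1, Nat.mod_eq_of_lt (by omega)] at h; omega

/-- The `2 ^ n` residue classes are translates of each other and partition the group. -/
theorem haar2_res_le (n m : ℕ) : haar2.real {z | res n z = m} ≤ 1 / 2 ^ n := by
  rcases lt_or_ge m (2 ^ n) with hm | hm
  · have h0 : ∀ k < 2 ^ n, haar2.real {z | res n z = k} = haar2.real {z | res n z = 0} := by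
      intro k hk
      have := haar2_res_add n 0 k (by omega)
      rw [zero_add] at this
      exact this.symm
    have hd := measureReal_biUnion_finset (μ := haar2) (s := Finset.range (2 ^ n))
      (f := fun k => {z | res n z = k})
      (fun i _ j _ hij => Set.disjoint_left.2 fun z (h1 : res n z = i) (h2 : res n z = j) =>
        hij (h1.symm.trans h2))
      (fun k _ => measurable_res n (measurableSet_singleton k))
    have hu : (⋃ k ∈ Finset.range (2 ^ n), {z | res n z = k}) = Set.univ := by
      ext z; simp [res_lt]
    rw [hu, Finset.sum_congr rfl fun k hk => h0 k (Finset.mem_range.1 hk)] at hd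
    simp only [probReal_univ, Finset.sum_const, Finset.card_range, nsmul_eq_mul, Nat.cast_pow,
      Nat.cast_ofNat] at hd
    rw [h0 m hm, le_div_iff₀ (by positivity), mul_comm, ← hd]
  · have : {z | res n z = m} = ∅ := by
      ext z
      have := res_lt n z
      simp only [Set.mem_ofPred_eq, Set.mem_empty_iff_false, iff_false]
      omega
    rw [this]
    simp

theorem haar2_res_mem_le (n : ℕ) (s : Finset ℕ) :
    haar2.real {z | res n z ∈ s} ≤ s.card / 2 ^ n := by
  have hu : {z | res n z ∈ s} = ⋃ k ∈ s, {z | res n z = k} := by ext z; simp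
  rw [hu]
  calc _ ≤ ∑ k ∈ s, haar2.real {z | res n z = k} := measureReal_biUnion_finset_le _ _
    _ ≤ ∑ _k ∈ s, (1 : ℝ) / 2 ^ n := Finset.sum_le_sum fun k _ => haar2_res_le n k
    _ = _ := by simp [div_eq_mul_inv]

/-! ### The spacer function -/

/-- The exponents `E` of the moduli `2 ^ E n` and the numbers `a n i` of spacers. -/
structure Odo where
  E : ℕ → ℕ
  a : ℕ → ℕ → ℕ
  L : ℕ
  E_zero : E 0 = 0
  E_lt : ∀ n, E n < E (n + 1)
  L_pos : 0 < L
  a_lt : ∀ n i, a n i < L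

namespace Odo

variable (D : Odo)

theorem strictMono_E : StrictMono D.E := strictMono_nat_of_lt_succ D.E_lt

theorem le_E (n : ℕ) : n ≤ D.E n := D.strictMono_E.le_apply

open Classical in
/-- The number of spacers below a point of the odometer. -/
def spacer (z : ℤ_[2]) : ℕ :=
  if h : ∃ n, res (D.E (n + 1)) z ≠ 0 then
    D.a (Nat.find h) (res (D.E (Nat.find h + 1)) z / 2 ^ D.E (Nat.find h)) else 0

theorem spacer_lt (z : ℤ_[2]) : D.spacer z < D.L := by
  unfold spacer
  split_ifs
  · exact D.a_lt _ _
  · exact D.L_pos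

theorem spacer_eq {z : ℤ_[2]} {n i : ℕ} (h : res (D.E (n + 1)) z = i * 2 ^ D.E n) (hi : 0 < i) :
    D.spacer z = D.a n i := by
  classical
  have hne : res (D.E (n + 1)) z ≠ 0 := by rw [h]; positivity
  have hex : ∃ n, res (D.E (n + 1)) z ≠ 0 := ⟨n, hne⟩
  have hfind : Nat.find hex = n := by
    rw [Nat.find_eq_iff]
    refine ⟨hne, fun k hk => ?_⟩
    rw [not_not, ← res_mod (D.strictMono_E.monotone (by omega : k + 1 ≤ n + 1)), h]
    exact Nat.mod_eq_zero_of_dvd (Dvd.dvd.mul_left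
      (pow_dvd_pow 2 (D.strictMono_E.monotone (by omega))) _)
  unfold spacer
  rw [dif_pos hex]
  have : ∀ k, k = n → D.a k (res (D.E (k + 1)) z / 2 ^ D.E k) = D.a n i := by
    rintro k rfl
    rw [h, Nat.mul_div_cancel _ (by positivity)]
  convert! this _ hfind

/-- The number of spacers depends only on the first nonzero block of binary digits, and a nonzero
residue modulo `2 ^ D.E n` already contains it. -/
theorem spacer_congr {z w : ℤ_[2]} {n : ℕ} (h : res (D.E n) z = res (D.E n) w)
    (h0 : res (D.E n) z ≠ 0) : D.spacer z = D.spacer w := by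
  induction n with
  | zero =>
    have := res_lt (D.E 0) z
    rw [D.E_zero] at this h0
    simp at this
    exact (h0 this).elim
  | succ n ih =>
    have hle := D.strictMono_E.monotone (Nat.le_succ n)
    by_cases h1 : res (D.E n) z = 0
    · have hdvd : 2 ^ D.E n ∣ res (D.E (n + 1)) z :=
        Nat.dvd_of_mod_eq_zero (by rw [res_mod hle, h1])
      obtain ⟨i, hi⟩ := hdvd
      rw [mul_comm] at hi
      have hi0 : 0 < i := by
        rcases Nat.eq_zero_or_pos i with rfl | h'
        · simp at hi; exact (h0 hi).elim
        · exact h'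
      rw [D.spacer_eq hi hi0, D.spacer_eq (h ▸ hi) hi0]
    · exact ih (by rw [← res_mod hle, h, res_mod hle]) h1

theorem measurable_spacer : Measurable D.spacer := by
  refine measurable_to_countable' fun v => ?_
  have : D.spacer ⁻¹' {v} =
      (⋃ n, ⋃ i ∈ {i | 0 < i ∧ D.a n i = v}, res (D.E (n + 1)) ⁻¹' {i * 2 ^ D.E n}) ∪
        ((⋂ n, res (D.E n) ⁻¹' {0}) ∩ {_z | v = 0}) := by
    ext z
    simp only [Set.mem_preimage, Set.mem_singleton_iff, Set.mem_union, Set.mem_iUnion,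
      Set.mem_ofPred_eq, exists_prop, Set.mem_inter_iff, Set.mem_iInter]
    by_cases hz : ∃ n i, 0 < i ∧ res (D.E (n + 1)) z = i * 2 ^ D.E n
    · obtain ⟨n, i, hi, h⟩ := hz
      rw [D.spacer_eq h hi]
      constructor
      · exact fun hv => Or.inl ⟨n, i, ⟨hi, hv⟩, h⟩
      · rintro (⟨k, l, ⟨hl, rfl⟩, h'⟩ | ⟨h0, _⟩)
        · rw [← D.spacer_eq h hi, D.spacer_eq h' hl]
        · have := h0 (n + 1)
          rw [h] at this
          have : 0 < i * 2 ^ D.E n := by positivity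
          omega
    · have h0 : ∀ n, res (D.E n) z = 0 := by
        intro n
        induction n with
        | zero =>
          have := res_lt (D.E 0) z
          rw [D.E_zero] at this ⊢
          simpa using this
        | succ n ih =>
          by_contra hne
          have hle := D.strictMono_E.monotone (Nat.le_succ n)
          obtain ⟨i, hi⟩ : 2 ^ D.E n ∣ res (D.E (n + 1)) z :=
            Nat.dvd_of_mod_eq_zero (by rw [res_mod hle, ih])
          refine hz ⟨n, i, ?_, by rw [hi, mul_comm]⟩
          rcases Nat.eq_zero_or_pos i with rfl | h'
          · simp at hi; exact (hne hi).elim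
          · exact h'
      have hs : D.spacer z = 0 := by
        unfold spacer
        rw [dif_neg]
        rintro ⟨n, hn⟩
        exact hn (h0 _)
      rw [hs]
      constructor
      · exact fun hv => Or.inr ⟨h0, hv.symm⟩
      · rintro (⟨k, l, ⟨hl, _⟩, h'⟩ | ⟨_, hv⟩)
        · exact (hz ⟨k, l, hl, h'⟩).elim
        · exact hv.symm
  rw [this]
  refine (MeasurableSet.iUnion fun n => MeasurableSet.biUnion (Set.to_countable _) fun i _ =>
    measurable_res _ (measurableSet_singleton _)).union ?_
  exact (MeasurableSet.iInter fun n => measurable_res _ (measurableSet_singleton 0)).inter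
    (MeasurableSet.const _)

end Odo

/-! ### The rank one system: towers, levels and spacers -/

namespace Odo

variable (D : Odo)

theorem measurable_roof : Measurable fun w : ℤ_[2] => D.spacer (w + 1) :=
  D.measurable_spacer.comp (measurable_add_const 1)

/-- The space of the rank one system with spacer function `D.spacer`. -/
abbrev Space : Type := Skyscraper fun w : ℤ_[2] => D.spacer (w + 1)

/-- The rank one transformation. -/
def T : D.Space ≃ᵐ D.Space := Skyscraper.measurableShift odometer D.measurable_roof

/-- The invariant probability measure of the rank one system. -/
def μ : Measure D.Space := Skyscraper.probMeasure haar2 _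

instance : IsProbabilityMeasure D.μ :=
  Skyscraper.isProbabilityMeasure_probMeasure D.measurable_roof fun _ => D.spacer_lt _

theorem measurePreserving_T : MeasurePreserving D.T D.μ D.μ :=
  Skyscraper.measurePreserving_probMeasure measurePreserving_odometer D.measurable_roof

instance : StandardBorelSpace D.Space :=
  (Skyscraper.measurableSet_skyscraper D.measurable_roof).standardBorel

theorem measureReal_base_le {A : Set ℤ_[2]} (hA : MeasurableSet A) :
    D.μ.real {x | x.1.1 ∈ A} ≤ D.L * haar2.real A :=
  Skyscraper.probMeasure_preimage_le D.measurable_roof (fun _ => D.spacer_lt _) hA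

theorem T_apply_of_lt {x : D.Space} (h : x.1.2 < D.spacer (x.1.1 + 1)) :
    D.T x = ⟨(x.1.1, x.1.2 + 1), h⟩ :=
  Skyscraper.shift_apply_of_lt odometer.toEquiv h

theorem T_apply_of_eq {x : D.Space} (h : x.1.2 = D.spacer (x.1.1 + 1)) :
    D.T x = ⟨(x.1.1 + 1, 0), Nat.zero_le _⟩ :=
  Skyscraper.shift_apply_of_eq odometer.toEquiv h

/-- The time from the bottom of a tower to its `m`-th level that is not a spacer. -/
def levelTime (m : ℕ) : ℕ := m + ∑ i ∈ Finset.range m, D.spacer ((i + 1 : ℕ) : ℤ_[2])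

theorem levelTime_succ (m : ℕ) :
    D.levelTime (m + 1) = D.levelTime m + 1 + D.spacer ((m + 1 : ℕ) : ℤ_[2]) := by
  unfold levelTime
  rw [Finset.sum_range_succ]
  ring

theorem levelTime_zero : D.levelTime 0 = 0 := by simp [levelTime]

theorem strictMono_levelTime : StrictMono D.levelTime :=
  strictMono_nat_of_lt_succ fun m => by rw [levelTime_succ]; omega

/-- The height of the `n`-th tower. -/
def ht (n : ℕ) : ℕ := D.levelTime (2 ^ D.E n - 1) + 1

/-- The level of a point in the `n`-th tower; the values from `D.ht n` on are taken on the
spacers that are put between the `n`-th towers. -/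
def offset (n : ℕ) (x : D.Space) : ℕ := D.levelTime (res (D.E n) x.1.1) + x.1.2

/-- The numbers of spacers that follow the successive visits to the `n`-th tower. -/
def gap (n : ℕ) (x : D.Space) (i : ℕ) : ℕ :=
  D.spacer (x.1.1 - (res (D.E n) x.1.1 : ℕ) + ((i + 1) * 2 ^ D.E n : ℕ))

theorem spacer_add_one {n : ℕ} {w : ℤ_[2]} (h : res (D.E n) w + 1 < 2 ^ D.E n) :
    D.spacer (w + 1) = D.spacer ((res (D.E n) w + 1 : ℕ) : ℤ_[2]) := by
  have h1 : res (D.E n) (w + 1) = res (D.E n) w + 1 := by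
    have := res_add_natCast (D.E n) w 1
    rwa [Nat.cast_one, Nat.mod_eq_of_lt h] at this
  refine D.spacer_congr (n := n) ?_ (by omega)
  rw [h1, res_natCast, Nat.mod_eq_of_lt h]

theorem res_cases (n : ℕ) (w : ℤ_[2]) :
    res (D.E n) w + 1 < 2 ^ D.E n ∨ res (D.E n) w = 2 ^ D.E n - 1 := by
  have := res_lt (D.E n) w
  omega

theorem offset_lt_levelTime {n : ℕ} {x : D.Space} (h : res (D.E n) x.1.1 + 1 < 2 ^ D.E n) :
    D.offset n x < D.levelTime (res (D.E n) x.1.1 + 1) := by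
  have h1 : x.1.2 ≤ D.spacer (x.1.1 + 1) := x.2
  rw [D.spacer_add_one h] at h1
  rw [levelTime_succ, offset]
  omega

theorem levelTime_lt_ht {n m : ℕ} (h : m < 2 ^ D.E n) : D.levelTime m < D.ht n :=
  Nat.lt_succ_of_le (D.strictMono_levelTime.monotone (by omega))

theorem offset_lt_ht {n : ℕ} {x : D.Space} (h : res (D.E n) x.1.1 + 1 < 2 ^ D.E n) :
    D.offset n x + 1 < D.ht n := by
  have h1 := D.offset_lt_levelTime h
  have h2 := D.levelTime_lt_ht h
  omega

theorem offset_of_top {n : ℕ} {x : D.Space} (h : res (D.E n) x.1.1 = 2 ^ D.E n - 1) :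
    D.offset n x + 1 = D.ht n + x.1.2 := by
  rw [offset, h, ht]; ring

theorem gap_of_top {n : ℕ} {x : D.Space} (h : res (D.E n) x.1.1 = 2 ^ D.E n - 1) :
    D.gap n x 0 = D.spacer (x.1.1 + 1) := by
  rw [gap, h]
  congr 1
  have : 0 < 2 ^ D.E n := by positivity
  rw [Nat.cast_sub this]
  push_cast
  ring

theorem res_add_one_of_top {n : ℕ} {w : ℤ_[2]} (h : res (D.E n) w = 2 ^ D.E n - 1) :
    res (D.E n) (w + 1) = 0 := by
  have := res_add_natCast (D.E n) w 1
  have h0 : 0 < 2 ^ D.E n := by positivity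
  rwa [Nat.cast_one, h, Nat.sub_add_cancel h0, Nat.mod_self] at this

theorem res_add_one {n : ℕ} {w : ℤ_[2]} (h : res (D.E n) w + 1 < 2 ^ D.E n) :
    res (D.E n) (w + 1) = res (D.E n) w + 1 := by
  have := res_add_natCast (D.E n) w 1
  rwa [Nat.cast_one, Nat.mod_eq_of_lt h] at this

/-- The odometer point minus its residue, the base of the current tower, is constant during a visit
and grows by `2 ^ D.E n` at the next one. -/
theorem blockCoding (n : ℕ) : BlockCoding D.T (D.ht n) D.L (D.offset n) (D.gap n) where
  z_lt x i := D.spacer_lt _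
  o_lt x := by
    rcases D.res_cases n x.1.1 with h | h
    · have := D.offset_lt_ht h; omega
    · have := D.offset_of_top h
      have h2 : x.1.2 ≤ D.spacer (x.1.1 + 1) := x.2
      rw [D.gap_of_top h]
      omega
  step x hx := by
    have hx2 : x.1.2 ≤ D.spacer (x.1.1 + 1) := x.2
    rcases hx2.lt_or_eq with hlt | heq
    · rw [D.T_apply_of_lt hlt]
      exact ⟨by simp only [offset]; ring, rfl⟩
    · rw [D.T_apply_of_eq heq]
      rcases D.res_cases n x.1.1 with h | h
      · have h1 := D.res_add_one h
        refine ⟨?_, ?_⟩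
        · simp only [offset, h1, heq]
          rw [levelTime_succ, D.spacer_add_one h]
          ring
        · funext i
          simp only [gap, h1]
          congr 1
          push_cast
          ring
      · have := D.offset_of_top h
        rw [D.gap_of_top h] at hx
        omega
  wrap x hx := by
    rcases D.res_cases n x.1.1 with h | h
    · have := D.offset_lt_ht h; omega
    · have h1 := D.offset_of_top h
      rw [D.gap_of_top h] at hx
      have heq : x.1.2 = D.spacer (x.1.1 + 1) := by omega
      have h2 := D.res_add_one_of_top h
      rw [D.T_apply_of_eq heq]
      refine ⟨by simp [offset, h2, levelTime_zero], ?_⟩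
      funext i
      simp only [gap, h2, h]
      congr 1
      have : 0 < 2 ^ D.E n := by positivity
      rw [Nat.cast_sub this]
      push_cast
      ring

/-- Below the top residue, the offset lies in the interval from `levelTime` of the residue to that
of its successor; these intervals are disjoint. -/
theorem offset_inj {n : ℕ} {x y : D.Space} (h : D.offset n x = D.offset n y) :
    res (D.E n) x.1.1 = res (D.E n) y.1.1 ∧ x.1.2 = y.1.2 := by
  have key : ∀ {x y : D.Space}, D.offset n x = D.offset n y →
      res (D.E n) y.1.1 ≤ res (D.E n) x.1.1 := by
    intro x y h
    by_contra! hlt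
    have h0 := res_lt (D.E n) y.1.1
    have h1 := D.offset_lt_levelTime (n := n) (x := x) (by omega)
    have h2 := D.strictMono_levelTime.monotone (Nat.succ_le_of_lt hlt)
    have h3 : D.levelTime (res (D.E n) y.1.1) ≤ D.offset n y := Nat.le_add_right _ _
    simp only [Nat.succ_eq_add_one] at h2
    omega
  have hr := le_antisymm (key h.symm) (key h)
  refine ⟨hr, ?_⟩
  unfold offset at h
  rw [hr] at h
  omega

theorem offset_congr {r n : ℕ} (hrn : r ≤ n) {x y : D.Space} (h : D.offset n x = D.offset n y) :
    D.offset r x = D.offset r y := by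
  obtain ⟨h1, h2⟩ := D.offset_inj h
  have hE := D.strictMono_E.monotone hrn
  rw [offset, offset, ← res_mod hE, ← res_mod hE, h1, h2]

theorem res_of_ht_le {n : ℕ} {x : D.Space} (h : D.ht n ≤ D.offset n x) :
    res (D.E n) x.1.1 = 2 ^ D.E n - 1 := by
  rcases D.res_cases n x.1.1 with h' | h'
  · have := D.offset_lt_ht h'; omega
  · exact h'

theorem offsetFactor {r n : ℕ} (hrn : r ≤ n) :
    OffsetFactor (D.ht n) (D.ht r) (D.offset n) (D.offset r) := by
  have hE := D.strictMono_E.monotone hrn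
  refine BlockCoding.offsetFactor_of_comp D.T.surjective (D.blockCoding n) (D.blockCoding r) ?_
    (fun x y h => D.offset_congr hrn h) ?_
  · intro x
    rw [offset, offset, ← res_mod hE]
    gcongr
    exact D.strictMono_levelTime.monotone (Nat.mod_le _ _)
  · intro x hx
    have h1 := D.res_of_ht_le hx
    have h2 := D.offset_of_top h1
    have h3 : res (D.E r) x.1.1 = 2 ^ D.E r - 1 := by
      obtain ⟨k, hk⟩ := pow_dvd_pow 2 hE
      rw [← res_mod hE, h1]
      have h0 : 0 < 2 ^ D.E r := by positivity
      have hk0 : 0 < k := by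
        rcases Nat.eq_zero_or_pos k with rfl | h'
        · simp at hk
        · exact h'
      obtain ⟨k, rfl⟩ := Nat.exists_eq_add_of_lt hk0
      -- The top level of the large tower is the top level of its last small tower, so spacers above
      -- the former lie above the latter as well.
      have : 2 ^ D.E n - 1 = (2 ^ D.E r - 1) + 2 ^ D.E r * k := by
        rw [hk, zero_add, mul_add, mul_one]; omega
      rw [this, Nat.add_mul_mod_self_left, Nat.mod_eq_of_lt (by omega)]
    have h4 := D.offset_of_top h3
    omega

theorem measurable_offset (n : ℕ) : Measurable (D.offset n) := by
  unfold offset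
  exact ((measurable_from_top (f := D.levelTime)).comp ((measurable_res _).comp
    (measurable_fst.comp measurable_subtype_coe))).add
    (measurable_snd.comp measurable_subtype_coe)

theorem measurable_gap (n i : ℕ) : Measurable fun x => D.gap n x i := by
  unfold gap
  refine D.measurable_spacer.comp ?_
  have h1 : Measurable fun x : D.Space => x.1.1 := measurable_fst.comp measurable_subtype_coe
  have h2 : Measurable fun x : D.Space => ((res (D.E n) x.1.1 : ℕ) : ℤ_[2]) :=
    (measurable_from_top (f := fun m : ℕ => (m : ℤ_[2]))).comp ((measurable_res _).comp h1)
  exact (h1.sub h2).add_const _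

theorem two_pow_le_ht (n : ℕ) : 2 ^ D.E n ≤ D.ht n := by
  have h1 : 2 ^ D.E n - 1 ≤ D.levelTime (2 ^ D.E n - 1) := by
    unfold levelTime; exact Nat.le_add_right _ _
  rw [ht]
  omega

theorem offset_lt (n : ℕ) (x : D.Space) : D.offset n x < D.ht n + D.L :=
  ((D.blockCoding n).o_lt x).trans (by have := (D.blockCoding n).z_lt x 0; omega)

/-- The points near the ends of the `n`-th tower. -/
def IsNearEnd (n : ℕ) (x : D.Space) : Prop := D.offset n x < D.L ∨ D.ht n ≤ D.offset n x

theorem measureReal_isNearEnd_le (n : ℕ) :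
    D.μ.real {x | D.IsNearEnd n x} ≤ D.L * ((D.L + 1) / 2 ^ D.E n) := by
  have hsub : {x | D.IsNearEnd n x} ⊆
      {x | x.1.1 ∈ {w | res (D.E n) w ∈ insert (2 ^ D.E n - 1) (Finset.range D.L)}} := by
    rintro x (h | h)
    -- The offset is at least the residue, so the near ends lie over at most `D.L + 1` residues.
    · have : res (D.E n) x.1.1 ≤ D.offset n x :=
        (D.strictMono_levelTime.le_apply).trans (Nat.le_add_right _ _)
      simp only [Set.mem_ofPred_eq, Finset.mem_insert, Finset.mem_range]
      right; omega
    · simp [D.res_of_ht_le h]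
  refine (measureReal_mono hsub).trans ((D.measureReal_base_le ?_).trans ?_)
  · exact measurable_res _ (Finset.measurableSet _)
  · refine mul_le_mul_of_nonneg_left ((haar2_res_mem_le _ _).trans ?_) (Nat.cast_nonneg _)
    gcongr
    have := Finset.card_insert_le (2 ^ D.E n - 1) (Finset.range D.L)
    rw [Finset.card_range] at this
    exact_mod_cast this

theorem tendsto_two_pow_E : Tendsto (fun n => (2 : ℝ) ^ D.E n) atTop atTop :=
  (tendsto_pow_atTop_atTop_of_one_lt one_lt_two).comp D.strictMono_E.tendsto_atTop

theorem tendsto_isNearEnd : Tendsto (fun n => D.μ.real {x | D.IsNearEnd n x}) atTop (nhds 0) := by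
  refine squeeze_zero (fun _ => measureReal_nonneg) (fun n => D.measureReal_isNearEnd_le n) ?_
  have := (tendsto_const_nhds (x := (D.L + 1 : ℝ))).div_atTop D.tendsto_two_pow_E
  simpa using this.const_mul (D.L : ℝ)

instance : NullSingletonClass D.μ := by
  refine ⟨fun x => ?_⟩
  have h1 : ∀ n, D.μ.real {x} ≤ D.L * (1 / 2 ^ D.E n) := by
    intro n
    have hsub : ({x} : Set D.Space) ⊆ {y | y.1.1 ∈ {w | res (D.E n) w = res (D.E n) x.1.1}} := by
      rintro y rfl; rfl
    refine (measureReal_mono hsub).trans ((D.measureReal_base_le ?_).trans ?_)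
    · exact measurable_res _ (measurableSet_singleton _)
    · exact mul_le_mul_of_nonneg_left (haar2_res_le _ _) (Nat.cast_nonneg _)
  have h2 : Tendsto (fun n => (D.L : ℝ) * (1 / 2 ^ D.E n)) atTop (nhds 0) := by
    have := (tendsto_const_nhds (x := (1 : ℝ))).div_atTop D.tendsto_two_pow_E
    simpa using this.const_mul (D.L : ℝ)
  have h3 : D.μ.real {x} ≤ 0 := ge_of_tendsto' h2 h1
  have h4 : D.μ.real {x} = 0 := le_antisymm h3 measureReal_nonneg
  rwa [measureReal_eq_zero_iff] at h4

/-! ### Approximation of measurable sets by levels -/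

theorem exists_offset_preimage {r n : ℕ} (hrn : r ≤ n) (S : Set ℕ) :
    ∃ S', D.offset n ⁻¹' S' = D.offset r ⁻¹' S := by
  refine ⟨D.offset n '' (D.offset r ⁻¹' S), Set.Subset.antisymm ?_ (Set.subset_preimage_image _ _)⟩
  rintro x ⟨y, hy, hxy⟩
  have := D.offset_congr hrn hxy
  rw [Set.mem_preimage] at hy ⊢
  rwa [← this]

/-- The sequence of all offsets is an injective measurable map on a standard Borel space, hence a
measurable embedding by Lusin–Souslin. -/
theorem measurableSpace_eq_generateFrom :
    (inferInstance : MeasurableSpace D.Space) =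
      MeasurableSpace.generateFrom {A | ∃ r S, A = D.offset r ⁻¹' S} := by
  have hm : Measurable fun (x : D.Space) (n : ℕ) => D.offset n x :=
    measurable_pi_lambda _ D.measurable_offset
  have hinj : Function.Injective fun (x : D.Space) (n : ℕ) => D.offset n x := by
    intro x y h
    have h' : ∀ n, D.offset n x = D.offset n y := fun n => congrFun h n
    refine Skyscraper.ext_iff'.2 ⟨eq_of_res_eq fun N => ⟨D.E N, D.le_E N, (D.offset_inj (h' N)).1⟩,
      (D.offset_inj (h' 0)).2⟩
  have hemb := (hm.measurableEmbedding hinj).comap_eq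
  refine le_antisymm ?_ ?_
  · rw [← hemb, MeasurableSpace.pi, MeasurableSpace.comap_iSup]
    refine iSup_le fun n => ?_
    rw [MeasurableSpace.comap_comp]
    rintro A ⟨S, -, rfl⟩
    exact MeasurableSpace.measurableSet_generateFrom ⟨n, S, rfl⟩
  · refine MeasurableSpace.generateFrom_le ?_
    rintro A ⟨r, S, rfl⟩
    exact D.measurable_offset r (MeasurableSet.of_discrete)

/-- Offsets refine each other, so the sets defined by a single offset form an algebra; a generating
algebra is dense in measure. -/
theorem exists_measure_symmDiff_lt {B : Set D.Space} (hB : MeasurableSet B) {ε : ℝ} (hε : 0 < ε) :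
    ∃ r S, D.μ (symmDiff B (D.offset r ⁻¹' S)) < ENNReal.ofReal ε := by
  have halg : IsSetAlgebra {A | ∃ r S, A = D.offset r ⁻¹' S} := by
    refine ⟨⟨0, ∅, by simp⟩, ?_, ?_⟩
    · rintro A ⟨r, S, rfl⟩
      exact ⟨r, Sᶜ, rfl⟩
    · rintro A B ⟨r, S, rfl⟩ ⟨k, S', rfl⟩
      obtain ⟨U, hU⟩ := D.exists_offset_preimage (le_max_left r k) S
      obtain ⟨V, hV⟩ := D.exists_offset_preimage (le_max_right r k) S'
      exact ⟨max r k, U ∪ V, by rw [Set.preimage_union, hU, hV]⟩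
  have hd := Measure.MeasureDense.of_generateFrom_isSetAlgebra_finite (μ := D.μ) halg
    D.measurableSpace_eq_generateFrom
  obtain ⟨A, ⟨r, S, rfl⟩, h⟩ := hd.approx B hB (measure_ne_top _ _) ε hε
  exact ⟨r, S, h⟩

end Odo

namespace Odo

variable (D : Odo)

/-! ### The cutting and stacking structure -/

/-- The number of columns into which the `n`-th tower is cut. -/
def q (n : ℕ) : ℕ := 2 ^ (D.E (n + 1) - D.E n)

theorem two_pow_E_succ (n : ℕ) : 2 ^ D.E (n + 1) = D.q n * 2 ^ D.E n := by
  rw [q, ← pow_add, Nat.sub_add_cancel (D.E_lt n).le]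

theorem two_le_q (n : ℕ) : 2 ≤ D.q n := by
  have := D.E_lt n
  exact Nat.le_self_pow (by omega) 2

theorem spacer_natCast_mul {n i : ℕ} (hi : 0 < i) (hi' : i < D.q n) :
    D.spacer ((i * 2 ^ D.E n : ℕ) : ℤ_[2]) = D.a n i := by
  refine D.spacer_eq ?_ hi
  rw [res_natCast, Nat.mod_eq_of_lt]
  rw [two_pow_E_succ]
  exact Nat.mul_lt_mul_of_pos_right hi' (by positivity)

/-- Inside a copy of the `n`-th tower the spacers do not depend on the copy. -/
theorem levelTime_add {n b m : ℕ} (hm : m < 2 ^ D.E n) :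
    D.levelTime (b * 2 ^ D.E n + m) = D.levelTime (b * 2 ^ D.E n) + D.levelTime m := by
  induction m with
  | zero => simp [levelTime_zero]
  | succ m ih =>
    rw [← add_assoc, levelTime_succ, levelTime_succ, ih (by omega)]
    have : D.spacer ((b * 2 ^ D.E n + m + 1 : ℕ) : ℤ_[2]) = D.spacer ((m + 1 : ℕ) : ℤ_[2]) := by
      have h1 : (b * 2 ^ D.E n + m + 1) % 2 ^ D.E n = m + 1 := by
        rw [add_assoc, Nat.add_comm, Nat.add_mul_mod_self_right, Nat.mod_eq_of_lt hm]
      refine D.spacer_congr (n := n) ?_ ?_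
      · rw [res_natCast, res_natCast, h1, Nat.mod_eq_of_lt hm]
      · rw [res_natCast, h1]; omega
    rw [this]
    ring

theorem levelTime_mul {n b : ℕ} (hb : b < D.q n) :
    D.levelTime (b * 2 ^ D.E n) = b * D.ht n + ∑ i ∈ Finset.Ico 1 (b + 1), D.a n i := by
  induction b with
  | zero => simp [levelTime_zero]
  | succ b ih =>
    have h0 : 0 < 2 ^ D.E n := by positivity
    have h1 : (b + 1) * 2 ^ D.E n = (b * 2 ^ D.E n + (2 ^ D.E n - 1)) + 1 := by
      rw [add_mul, one_mul]; omega
    have h2 := D.spacer_natCast_mul (n := n) (Nat.succ_pos b) hb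
    rw [Nat.succ_eq_add_one, h1] at h2
    rw [h1, levelTime_succ, h2, D.levelTime_add (by omega), ih (by omega),
      Finset.sum_Ico_succ_top (by omega : 1 ≤ b + 1), ht]
    ring

theorem ht_succ (n : ℕ) : D.ht (n + 1) = D.q n * D.ht n + ∑ i ∈ Finset.Ico 1 (D.q n), D.a n i := by
  have h0 : 0 < 2 ^ D.E n := by positivity
  have hq := D.two_le_q n
  have h1 : 2 ^ D.E (n + 1) - 1 = (D.q n - 1) * 2 ^ D.E n + (2 ^ D.E n - 1) := by
    rw [two_pow_E_succ]
    obtain ⟨k, hk⟩ := Nat.exists_eq_add_of_le' hq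
    rw [hk]
    have : (k + 2) * 2 ^ D.E n = (k + 2 - 1) * 2 ^ D.E n + 2 ^ D.E n := by
      have : k + 2 - 1 = k + 1 := rfl
      rw [this]; ring
    omega
  rw [ht, h1, D.levelTime_add (by omega), D.levelTime_mul (by omega),
    Nat.sub_add_cancel (by omega : 1 ≤ D.q n), add_assoc _ _ 1, ← ht]
  obtain ⟨k, hk⟩ := Nat.exists_eq_add_of_le' hq
  rw [hk]
  have : k + 2 - 1 = k + 1 := rfl
  rw [this]
  ring

theorem ht_zero : D.ht 0 = 1 := by
  rw [ht, D.E_zero]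
  simp [levelTime_zero]

theorem height_eq (n : ℕ) : height D.q D.a n = D.ht n := by
  induction n with
  | zero => rw [height, ht_zero]
  | succ n ih => rw [height, ih, spacerCount, ht_succ]

theorem ht_pos (n : ℕ) : 0 < D.ht n := Nat.succ_pos _

theorem summable_spacers :
    Summable fun n => (spacerCount D.q D.a n : ℝ) / (height D.q D.a (n + 1) : ℝ) := by
  have hs : Summable fun n => (D.L : ℝ) * (1 / 2) ^ n :=
    (summable_geometric_of_lt_one (by norm_num) (by norm_num)).mul_left _
  refine Summable.of_nonneg_of_le (fun n => by positivity) (fun n => ?_) hs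
  have h1 : spacerCount D.q D.a n ≤ D.q n * D.L := by
    rw [spacerCount]
    calc _ ≤ ∑ _i ∈ Finset.Ico 1 (D.q n), D.L := Finset.sum_le_sum fun i _ => (D.a_lt n i).le
      _ ≤ _ := by
        rw [Finset.sum_const, Nat.card_Ico, smul_eq_mul]
        exact Nat.mul_le_mul_right _ (Nat.sub_le _ _)
  have h2 : D.q n * 2 ^ n ≤ height D.q D.a (n + 1) := by
    rw [height, height_eq]
    refine le_trans (Nat.mul_le_mul_left _ ?_) (Nat.le_add_right _ _)
    exact (Nat.pow_le_pow_right two_pos (D.le_E n)).trans (D.two_pow_le_ht n)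
  have hq : 0 < D.q n := by have := D.two_le_q n; omega
  calc (spacerCount D.q D.a n : ℝ) / (height D.q D.a (n + 1) : ℝ)
      ≤ ((D.q n * D.L : ℕ) : ℝ) / ((D.q n * 2 ^ n : ℕ) : ℝ) := by
        have h3 : (0 : ℝ) < ((D.q n * 2 ^ n : ℕ) : ℝ) := by exact_mod_cast (by positivity)
        gcongr
    _ = D.L * (1 / 2) ^ n := by
        push_cast
        have : (D.q n : ℝ) ≠ 0 := by exact_mod_cast hq.ne'
        rw [one_div, inv_pow]
        field_simp

/-- The base of the `n`-th tower. -/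
def base (n : ℕ) : Set D.Space := {x | D.offset n x = 0}

theorem image_base {n k : ℕ} (hk : k < D.ht n) :
    D.T^[k] '' D.base n = {x | D.offset n x = k} := by
  induction k with
  | zero => simp [base]
  | succ k ih =>
    rw [Function.iterate_succ', Set.image_comp, ih (by omega)]
    ext y
    constructor
    · rintro ⟨x, hx, rfl⟩
      have hx' : D.offset n x = k := hx
      have := ((D.blockCoding n).step x (by omega)).1
      simp [this, hx']
    · intro hy
      have hy' : D.offset n y = k + 1 := hy
      obtain ⟨x, rfl⟩ := D.T.surjective y
      refine ⟨x, ?_, rfl⟩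
      rcases (Nat.succ_le_of_lt ((D.blockCoding n).o_lt x)).lt_or_eq with hlt | heq
      · have := ((D.blockCoding n).step x hlt).1
        simp only [Set.mem_ofPred_eq]
        omega
      · have := ((D.blockCoding n).wrap x heq).1
        omega

/-- The base of the `i`-th column of the `n`-th tower. -/
def colBase (n i : ℕ) : Set D.Space :=
  {x | res (D.E (n + 1)) x.1.1 = (i - 1) * 2 ^ D.E n ∧ x.1.2 = 0}

theorem offset_eq_zero_iff {n : ℕ} {x : D.Space} :
    D.offset n x = 0 ↔ res (D.E n) x.1.1 = 0 ∧ x.1.2 = 0 := by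
  rw [offset, Nat.add_eq_zero_iff]
  refine and_congr_left fun _ => ⟨fun h => ?_, fun h => by rw [h, levelTime_zero]⟩
  have := D.strictMono_levelTime.le_apply (x := res (D.E n) x.1.1)
  omega

theorem iterate_climb (w : ℤ_[2]) {j : ℕ} (hj : j ≤ D.spacer (w + 1)) :
    D.T^[j] (⟨(w, 0), Nat.zero_le _⟩ : D.Space) = ⟨(w, j), hj⟩ := by
  induction j with
  | zero => rfl
  | succ j ih =>
    rw [Function.iterate_succ_apply', ih (by omega)]
    exact D.T_apply_of_lt (x := ⟨(w, j), (Nat.le_succ j).trans hj⟩) hj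

theorem iterate_return (w : ℤ_[2]) :
    D.T^[D.spacer (w + 1) + 1] (⟨(w, 0), Nat.zero_le _⟩ : D.Space) =
      ⟨(w + 1, 0), Nat.zero_le _⟩ := by
  rw [Function.iterate_succ_apply', D.iterate_climb w le_rfl]
  exact D.T_apply_of_eq (x := ⟨(w, _), le_rfl⟩) rfl

theorem iterate_levelTime {n : ℕ} {w : ℤ_[2]} (hw : res (D.E n) w = 0) {m : ℕ}
    (hm : m < 2 ^ D.E n) :
    D.T^[D.levelTime m] (⟨(w, 0), Nat.zero_le _⟩ : D.Space) = ⟨(w + m, 0), Nat.zero_le _⟩ := by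
  induction m with
  | zero => simp [levelTime_zero]
  | succ m ih =>
    have h1 : res (D.E n) (w + m) = m := by
      rw [res_add_natCast, hw, zero_add, Nat.mod_eq_of_lt (by omega)]
    have h2 : D.spacer ((m + 1 : ℕ) : ℤ_[2]) = D.spacer (w + m + 1) := by
      rw [D.spacer_add_one (n := n) (by omega), h1]
    have h3 : D.levelTime (m + 1) = (D.spacer (w + m + 1) + 1) + D.levelTime m := by
      rw [levelTime_succ, h2]; ring
    rw [h3, Function.iterate_add_apply, ih (by omega), iterate_return]
    simp [add_assoc]

theorem iterate_ht {n : ℕ} {w : ℤ_[2]} (hw : res (D.E n) w = 0) :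
    D.T^[D.ht n + D.spacer (w + (2 ^ D.E n : ℕ))] (⟨(w, 0), Nat.zero_le _⟩ : D.Space) =
      ⟨(w + (2 ^ D.E n : ℕ), 0), Nat.zero_le _⟩ := by
  have h0 : 0 < 2 ^ D.E n := by positivity
  have h1 : w + ((2 ^ D.E n - 1 : ℕ) : ℤ_[2]) + 1 = w + (2 ^ D.E n : ℕ) := by
    rw [Nat.cast_sub h0]; push_cast; ring
  have h2 : D.ht n + D.spacer (w + (2 ^ D.E n : ℕ)) =
      (D.spacer (w + ((2 ^ D.E n - 1 : ℕ) : ℤ_[2]) + 1) + 1) + D.levelTime (2 ^ D.E n - 1) := by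
    rw [h1, ht]; ring
  rw [h2, Function.iterate_add_apply, D.iterate_levelTime hw (by omega), iterate_return]
  simp only [h1]

/-- Passing the tower and its `a n i` spacers adds `2 ^ D.E n` to the odometer point, hence `1` to
the column number. -/
theorem image_colBase {n i : ℕ} (hi : 1 ≤ i) (hiq : i < D.q n) :
    D.T^[D.ht n + D.a n i] '' D.colBase n i = D.colBase n (i + 1) := by
  have hE := (D.E_lt n).le
  have hQ : (i + 1) * 2 ^ D.E n ≤ 2 ^ D.E (n + 1) := by
    rw [two_pow_E_succ]; exact Nat.mul_le_mul_right _ hiq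
  have h0 : 0 < 2 ^ D.E n := by positivity
  have hi1 : (i - 1) * 2 ^ D.E n + 2 ^ D.E n = i * 2 ^ D.E n := by
    obtain ⟨k, rfl⟩ := Nat.exists_eq_add_of_le' hi
    simp; ring
  have hi2 : (i + 1) * 2 ^ D.E n = i * 2 ^ D.E n + 2 ^ D.E n := by ring
  have key : ∀ w : ℤ_[2], res (D.E (n + 1)) w = (i - 1) * 2 ^ D.E n →
      res (D.E (n + 1)) (w + (2 ^ D.E n : ℕ)) = i * 2 ^ D.E n ∧
      D.T^[D.ht n + D.a n i] (⟨(w, 0), Nat.zero_le _⟩ : D.Space) =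
        ⟨(w + (2 ^ D.E n : ℕ), 0), Nat.zero_le _⟩ := by
    intro w hw
    have h1 : res (D.E (n + 1)) (w + (2 ^ D.E n : ℕ)) = i * 2 ^ D.E n := by
      rw [res_add_natCast, hw, hi1, Nat.mod_eq_of_lt (by omega)]
    refine ⟨h1, ?_⟩
    rw [← D.spacer_eq h1 hi]
    exact D.iterate_ht (by rw [← res_mod hE, hw, Nat.mul_mod_left])
  ext y
  constructor
  · rintro ⟨⟨⟨w, j⟩, hj⟩, ⟨hw, hj0⟩, rfl⟩
    simp only at hw hj0
    subst hj0
    obtain ⟨h1, h2⟩ := key w hw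
    rw [h2]
    exact ⟨h1, rfl⟩
  · obtain ⟨⟨w, j⟩, hj⟩ := y
    rintro ⟨hw, hj0⟩
    simp only [Nat.add_sub_cancel] at hw hj0
    subst hj0
    have hw' : w = (w - (2 ^ D.E n : ℕ)) + (2 ^ D.E n : ℕ) := by ring
    have h1 : res (D.E (n + 1)) (w - (2 ^ D.E n : ℕ)) = (i - 1) * 2 ^ D.E n := by
      have h2 := res_lt (D.E (n + 1)) (w - (2 ^ D.E n : ℕ))
      have h3 := res_add_natCast (D.E (n + 1)) (w - (2 ^ D.E n : ℕ)) (2 ^ D.E n)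
      rw [← hw', hw] at h3
      have h4 : 2 ^ D.E n ≤ i * 2 ^ D.E n := Nat.le_mul_of_pos_left _ hi
      rcases lt_or_ge (res (D.E (n + 1)) (w - (2 ^ D.E n : ℕ)) + 2 ^ D.E n)
        (2 ^ D.E (n + 1)) with h | h
      · rw [Nat.mod_eq_of_lt h] at h3; omega
      · rw [Nat.mod_eq_sub_mod h, Nat.mod_eq_of_lt (by omega)] at h3; omega
    refine ⟨⟨(w - (2 ^ D.E n : ℕ), 0), Nat.zero_le _⟩, ⟨h1, rfl⟩, ?_⟩
    rw [(key _ h1).2]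
    simp

theorem measurableSet_colBase (n i : ℕ) : MeasurableSet (D.colBase n i) :=
  (((measurable_res _).comp (measurable_fst.comp measurable_subtype_coe))
    (measurableSet_singleton _)).inter
    ((measurable_snd.comp measurable_subtype_coe) (measurableSet_singleton 0))

theorem measurableSet_image_iterate {X : Type*} [MeasurableSpace X] (T : X ≃ᵐ X) (k : ℕ)
    {A : Set X} (hA : MeasurableSet A) : MeasurableSet (T^[k] '' A) := by
  induction k with
  | zero => simpa using hA
  | succ k ih =>
    rw [Function.iterate_succ', Set.image_comp]
    exact T.measurableEmbedding.measurableSet_image.2 ih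

theorem measureReal_ht_le_le (n : ℕ) :
    D.μ.real {x | D.ht n ≤ D.offset n x} ≤ D.μ.real {x | D.IsNearEnd n x} :=
  measureReal_mono fun _ hx => Or.inr hx

theorem approachesPoints :
    ApproachesPoints D.μ fun n => towerPartition D.T (D.base n) (D.ht n) := by
  intro B hB ε hε
  obtain ⟨e, he0, heε⟩ : ∃ e : ℝ, 0 < e ∧ ENNReal.ofReal e + ENNReal.ofReal e ≤ ε := by
    rcases eq_or_ne ε ⊤ with rfl | htop
    · exact ⟨1, one_pos, le_top⟩
    · refine ⟨ε.toReal / 2, half_pos (ENNReal.toReal_pos hε.ne' htop), ?_⟩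
      rw [← ENNReal.ofReal_add (by positivity) (by positivity), add_halves,
        ENNReal.ofReal_toReal htop]
  obtain ⟨r, S, hS⟩ := D.exists_measure_symmDiff_lt hB he0
  obtain ⟨N, hN⟩ := eventually_atTop.1 (D.tendsto_isNearEnd.eventually_lt_const he0)
  refine ⟨max r N, fun n hn => ?_⟩
  obtain ⟨S', hS'⟩ := D.exists_offset_preimage (le_of_max_le_left hn) S
  refine ⟨{A | ∃ k < D.ht n, k ∈ S' ∧ A = D.T^[k] '' D.base n}, ?_, ?_⟩
  · rintro A ⟨k, hk, -, rfl⟩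
    exact Or.inl ⟨k, hk, rfl⟩
  · have hsub : symmDiff B (⋃₀ {A | ∃ k < D.ht n, k ∈ S' ∧ A = D.T^[k] '' D.base n}) ⊆
        symmDiff B (D.offset r ⁻¹' S) ∪ {x | D.ht n ≤ D.offset n x} := by
      have hU : ⋃₀ {A | ∃ k < D.ht n, k ∈ S' ∧ A = D.T^[k] '' D.base n} =
          D.offset n ⁻¹' S' \ {x | D.ht n ≤ D.offset n x} := by
        ext x
        simp only [Set.mem_sUnion, Set.mem_ofPred_eq, Set.mem_sdiff, Set.mem_preimage, not_le]
        constructor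
        · rintro ⟨A, ⟨k, hk, hkS, rfl⟩, hx⟩
          rw [D.image_base hk] at hx
          have hx' : D.offset n x = k := hx
          rw [hx']; exact ⟨hkS, hk⟩
        · rintro ⟨h1, h2⟩
          refine ⟨_, ⟨_, h2, h1, rfl⟩, ?_⟩
          rw [D.image_base h2]; rfl
      rw [hU, ← hS']
      intro x hx
      simp only [Set.mem_symmDiff, Set.mem_sdiff, Set.mem_union] at hx ⊢
      tauto
    refine (measure_mono hsub).trans_lt ((measure_union_le _ _).trans_lt ?_)
    refine lt_of_lt_of_le (ENNReal.add_lt_add hS ?_) heε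
    have h1 := (D.measureReal_ht_le_le n).trans_lt (hN n (le_of_max_le_right hn))
    rw [← ENNReal.ofReal_toReal (measure_ne_top D.μ {x | D.ht n ≤ D.offset n x})]
    exact (ENNReal.ofReal_lt_ofReal_iff he0).2 h1

theorem isCutAndStack : IsCutAndStack D.μ D.T D.q D.a D.base D.colBase
    (fun n i j => D.T^[D.ht n + (j - 1)] '' D.colBase n i) where
  two_le_q := D.two_le_q
  summable_spacers := D.summable_spacers
  measurable_F n := D.measurable_offset n (measurableSet_singleton 0)
  measurable_Fs n i _ _ := D.measurableSet_colBase n i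
  measurable_C n i j _ _ _ _ := measurableSet_image_iterate _ _ (D.measurableSet_colBase n i)
  levels_disjoint n k l hk hl hkl := by
    rw [height_eq] at hk hl
    rw [D.image_base hk, D.image_base hl, Set.disjoint_left]
    intro x h1 h2
    exact hkl (Eq.trans (Eq.symm h1) h2)
  columns_disjoint n i j hi _ hj _ hij := by
    rw [Set.disjoint_left]
    rintro x ⟨h1, _⟩ ⟨h2, _⟩
    rw [h1] at h2
    have := Nat.eq_of_mul_eq_mul_right (by positivity) h2
    omega
  columns_cover n := by
    have hE := (D.E_lt n).le
    ext x
    simp only [base, D.offset_eq_zero_iff, Set.mem_iUnion, colBase, Set.mem_ofPred_eq,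
      exists_prop, Finset.mem_Icc]
    constructor
    · rintro ⟨h1, h2⟩
      obtain ⟨k, hk⟩ : 2 ^ D.E n ∣ res (D.E (n + 1)) x.1.1 :=
        Nat.dvd_of_mod_eq_zero (by rw [res_mod hE, h1])
      have hlt := res_lt (D.E (n + 1)) x.1.1
      rw [hk, two_pow_E_succ, mul_comm] at hlt
      have := lt_of_mul_lt_mul_right hlt (Nat.zero_le _)
      exact ⟨k + 1, ⟨by omega, by omega⟩, by rw [hk, Nat.add_sub_cancel, mul_comm], h2⟩
    · rintro ⟨i, _, h1, h2⟩
      exact ⟨by rw [← res_mod hE, h1, Nat.mul_mod_left], h2⟩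
  top_to_spacer n i _ _ _ := by rw [height_eq]; rfl
  top_to_next n i hi hiq h0 := by
    have := D.image_colBase hi hiq
    rwa [h0, add_zero, ← height_eq] at this
  spacer_to_spacer n i j _ _ hj _ := by
    rw [← Set.image_comp, ← Function.iterate_succ']
    congr 2
    omega
  spacer_to_next n i hi hiq h0 := by
    rw [← Set.image_comp, ← Function.iterate_succ', ← D.image_colBase hi hiq]
    congr 2
    omega
  next_base n := by
    ext x
    simp [base, D.offset_eq_zero_iff, colBase]
  generating := by
    simp_rw [height_eq]
    exact D.approachesPoints

theorem isRankOneSystem : IsRankOneSystem D.μ D.T where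
  standardBorel := inferInstance
  isProbabilityMeasure := inferInstance
  nullSingleton := inferInstance
  measurePreserving := D.measurePreserving_T
  cutAndStack := ⟨_, _, _, _, _, D.isCutAndStack⟩

end Odo

/-! ### Entropy of names and of lists of spacer numbers -/

namespace Odo

variable (D : Odo)

theorem measurable_iterate_T (k : ℕ) : Measurable D.T^[k] := D.T.measurable.iterate k

/-- The level in the `n`-th tower as an element of a finite type. -/
def offsetFin (n : ℕ) (x : D.Space) : Fin (D.ht n + D.L) := ⟨D.offset n x, D.offset_lt n x⟩

/-- The numbers of spacers following the next `W` visits to the `n`-th tower. -/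
def window (n W : ℕ) (x : D.Space) (i : Fin W) : Fin D.L := ⟨D.gap n x i, D.spacer_lt _⟩

theorem measurableSet_offsetFin (n : ℕ) (v : Fin (D.ht n + D.L)) :
    MeasurableSet (D.offsetFin n ⁻¹' {v}) := by
  have : D.offsetFin n ⁻¹' {v} = D.offset n ⁻¹' {v.1} := by
    ext x; simp [offsetFin, Fin.ext_iff]
  rw [this]
  exact D.measurable_offset n (measurableSet_singleton _)

theorem measurableSet_gapFin (n i : ℕ) (v : Fin D.L) :
    MeasurableSet ((fun x => (⟨D.gap n x i, D.spacer_lt _⟩ : Fin D.L)) ⁻¹' {v}) := by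
  have : (fun x => (⟨D.gap n x i, D.spacer_lt _⟩ : Fin D.L)) ⁻¹' {v} =
      (fun x => D.gap n x i) ⁻¹' {v.1} := by
    ext x; simp [Fin.ext_iff]
  rw [this]
  exact D.measurable_gap n i (measurableSet_singleton _)

theorem measurableSet_window (n W : ℕ) (v : Fin W → Fin D.L) :
    MeasurableSet (D.window n W ⁻¹' {v}) :=
  measurableSet_preimage_pi (fun k i => D.measurableSet_gapFin n k i) v

theorem measurable_ofPred_isNearEnd (n : ℕ) : MeasurableSet {x | D.IsNearEnd n x} :=
  (measurableSet_lt (D.measurable_offset n) measurable_const).union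
    (measurableSet_le measurable_const (D.measurable_offset n))

/-! ### Upper bound for the entropy of names -/

/-- The starting level in the `n`-th tower and the next `W` spacer numbers determine the name; they
take at most `(D.ht n + D.L) * D.L ^ W` values. -/
theorem shannonEntropy_seqCoding_offset_le {ι : Type*} [Fintype ι] (g : ℕ → ι) {r n : ℕ}
    (hrn : r ≤ n) {t : ℕ → ℕ} (ht : Monotone t) {N W : ℕ}
    (hW : D.ht n + D.L + t N ≤ W * D.ht n) :
    shannonEntropy D.μ (seqCoding D.T t (fun x => g (D.offset r x)) N) ≤
      Real.log (D.ht n + D.L) + W * Real.log D.L := by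
  have hm : ∀ v, MeasurableSet ((fun x => (D.offsetFin n x, D.window n W x)) ⁻¹' {v}) :=
    measurableSet_preimage_prodMk (D.measurableSet_offsetFin n) (D.measurableSet_window n W)
  refine (shannonEntropy_le_of_factor hm fun x y hxy => ?_).trans
    ((shannonEntropy_le_log_card hm).trans (le_of_eq ?_))
  · simp only [Prod.mk.injEq, offsetFin, Fin.mk.injEq] at hxy
    obtain ⟨h1, h2⟩ := hxy
    funext k
    have hk := (D.blockCoding n).offset_eq (t := t (k + 1)) (W := W) h1
      (fun l hl => congrArg Fin.val (congrFun h2 ⟨l, hl⟩))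
      (le_trans (Nat.add_le_add_left (ht k.2) _) hW)
    simp only [seqCoding]
    rw [D.offset_congr hrn hk]
  · have hL : (0 : ℝ) < D.L := by exact_mod_cast D.L_pos
    simp only [Fintype.card_prod, Fintype.card_fin, Fintype.card_fun]
    push_cast
    rw [Real.log_mul (by positivity) (by positivity), Real.log_pow]

/-- Up to a small error, the entropy of the names of a partition is bounded by that of a partition
into levels. -/
theorem exists_shannonEntropy_seqCoding_le {m : ℕ} {φ : D.Space → Fin m} (hφ : Measurable φ)
    (t : ℕ → ℕ) {ε : ℝ} (hε : 0 < ε) :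
    ∃ (r : ℕ) (g : ℕ → Fin m), ∀ N, shannonEntropy D.μ (seqCoding D.T t φ N) ≤
      shannonEntropy D.μ (seqCoding D.T t (fun x => g (D.offset r x)) N) + N * ε := by
  classical
  let _ : MeasurableSpace (Option (Fin m)) := ⊤
  have : DiscreteMeasurableSpace (Option (Fin m)) := ⟨fun _ => trivial⟩
  obtain ⟨δ, hδ, hsmall⟩ := exists_shannonEntropy_le (Option (Fin m)) hε
  obtain ⟨x₀⟩ : Nonempty D.Space := ⟨⟨(0, 0), Nat.zero_le _⟩⟩
  have hm : 0 < m := (Nat.zero_le _).trans_lt (φ x₀).2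
  have hδm : 0 < δ / m := by positivity
  choose r S hS using fun i : Fin m =>
    D.exists_measure_symmDiff_lt (hφ (measurableSet_singleton i)) hδm
  set R := Finset.univ.sup r with hR
  choose U hU using fun i : Fin m =>
    D.exists_offset_preimage (Finset.le_sup (Finset.mem_univ i) : r i ≤ R) (S i)
  -- Off the union of the approximation errors exactly one `U i` contains the level, so neither the
  -- choice nor the default matters.
  let g : ℕ → Fin m := fun v => if h : ∃ i, v ∈ U i then h.choose else φ x₀
  have hgm : Measurable fun x => g (D.offset R x) := 
    (measurable_from_top (f := g)).comp (D.measurable_offset R)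
  have herr : D.μ.real {x | φ x ≠ g (D.offset R x)} ≤ δ := by
    have hsub : {x | φ x ≠ g (D.offset R x)} ⊆
        ⋃ i ∈ (Finset.univ : Finset (Fin m)), symmDiff (φ ⁻¹' {i}) (D.offset (r i) ⁻¹' S i) := by
      intro x hx
      by_contra hno
      simp only [Finset.mem_univ, Set.iUnion_true, Set.mem_iUnion, not_exists] at hno
      refine hx ?_
      have key : ∀ i, D.offset R x ∈ U i ↔ φ x = i := by
        intro i
        have h1 := hno i
        rw [← hU i] at h1
        simp only [Set.mem_symmDiff, Set.mem_preimage, Set.mem_singleton_iff] at h1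
        tauto
      have hex : ∃ i, D.offset R x ∈ U i := ⟨φ x, (key _).2 rfl⟩
      simp only [g]
      rw [dif_pos hex]
      exact (key _).1 hex.choose_spec
    refine (measureReal_mono hsub (measure_ne_top _ _)).trans
      ((measureReal_biUnion_finset_le _ _).trans ?_)
    calc _ ≤ ∑ _i : Fin m, δ / m := Finset.sum_le_sum fun i _ => by
          rw [measureReal_def]
          exact (ENNReal.toReal_mono ENNReal.ofReal_ne_top (hS i).le).trans
            (ENNReal.toReal_ofReal hδm.le).le
      _ = δ := by
        have : (m : ℝ) ≠ 0 := by exact_mod_cast hm.ne'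
        simp; field_simp
  refine ⟨R, g, fun N => ?_⟩
  set ψ : D.Space → Fin m := fun x => g (D.offset R x) with hψ
  -- The correction `η` is `none` except on a small set, yet `ψ` and `η` together determine `φ`.
  let η : D.Space → Option (Fin m) := fun x => if φ x = ψ x then none else some (φ x)
  have hη : Measurable η := by
    refine Measurable.ite (measurableSet_eq_fun hφ hgm) measurable_const ?_
    exact (measurable_from_top (f := some)).comp hφ
  have hηH : shannonEntropy D.μ η ≤ ε := by
    refine hsmall D.μ η none (fun i => hη MeasurableSet.of_discrete) ?_
    convert! herr using 2
    ext x
    simp [η, hψ]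
  have hmψ : ∀ k (i : Fin m),
      MeasurableSet ((fun x => seqCoding D.T t ψ N x k) ⁻¹' {i}) := fun k i =>
    (hgm.comp (D.measurable_iterate_T _)) (measurableSet_singleton i)
  have hmη : ∀ k (i : Option (Fin m)),
      MeasurableSet ((fun x => seqCoding D.T t η N x k) ⁻¹' {i}) := fun k i =>
    (hη.comp (D.measurable_iterate_T _)) (MeasurableSet.of_discrete)
  calc shannonEntropy D.μ (seqCoding D.T t φ N)
      ≤ shannonEntropy D.μ (fun x => (seqCoding D.T t ψ N x, seqCoding D.T t η N x)) := by
        refine shannonEntropy_le_of_factor (measurableSet_preimage_prodMk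
          (measurableSet_preimage_pi hmψ) (measurableSet_preimage_pi hmη)) fun x y hxy => ?_
        rw [Prod.mk.injEq] at hxy
        funext k
        have h1 := congrFun hxy.1 k
        have h2 := congrFun hxy.2 k
        simp only [seqCoding] at h1 h2 ⊢
        simp only [η] at h2
        split_ifs at h2 with h3 h4 h4
        · rw [h3, h4, h1]
        · exact Option.some_injective _ h2
    _ ≤ _ := shannonEntropy_prod_le (measurableSet_preimage_pi hmψ) (measurableSet_preimage_pi hmη)
    _ ≤ _ := by
        gcongr
        refine (shannonEntropy_pi_le hmη).trans ?_
        calc _ ≤ ∑ _k : Fin N, ε := Finset.sum_le_sum fun k _ => by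
              refine le_trans (le_of_eq ?_) hηH
              exact shannonEntropy_comp_measurePreserving (D.measurePreserving_T.iterate _)
                fun i => hη MeasurableSet.of_discrete
          _ = _ := by simp

/-! ### Lower bound for the entropy of names -/

/-- The number of spacers above the current tower at time `t k`, recorded if the next observation
is near the end of a tower. -/
def edgeInfo (r n : ℕ) (t : ℕ → ℕ) (k : ℕ) (x : D.Space) : Option (Fin D.L) :=
  open Classical in
  if D.IsNearEnd r (D.T^[t (k + 1)] x) then some ⟨D.gap n (D.T^[t k] x) 0, D.spacer_lt _⟩ else none

theorem measurableSet_edgeInfo (r n : ℕ) (t : ℕ → ℕ) (k : ℕ) (v : Option (Fin D.L)) :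
    MeasurableSet (D.edgeInfo r n t k ⁻¹' {v}) := by
  classical
  let _ : MeasurableSpace (Option (Fin D.L)) := ⊤
  have : DiscreteMeasurableSpace (Option (Fin D.L)) := ⟨fun _ => trivial⟩
  have : Measurable (D.edgeInfo r n t k) := by
    unfold edgeInfo
    refine Measurable.ite (D.measurable_iterate_T _ (D.measurable_ofPred_isNearEnd r)) ?_
      measurable_const
    refine (measurable_from_top (f := some)).comp ?_
    refine measurable_to_countable' fun v => ?_
    exact D.measurable_iterate_T _ (D.measurableSet_gapFin n 0 v)
  exact this MeasurableSet.of_discrete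

/-- The names, the starting level in the `n`-th tower and the edge records decode the spacer numbers
of all towers left by time `t N`, at least `M` of them. The remaining `R` are supplied separately,
at the cost of `log D.L` each. -/
theorem shannonEntropy_window_le {r n : ℕ} (hrn : r ≤ n) {t : ℕ → ℕ} (ht0 : t 0 = 0)
    (ht : Monotone t) {N M R : ℕ} (hgap : ∀ k < N, t (k + 1) ≤ t k + D.ht n)
    (hM : M * (D.ht n + D.L) ≤ t N) {ε : ℝ}
    (hε : ∀ k, shannonEntropy D.μ (D.edgeInfo r n t k) ≤ ε) :
    shannonEntropy D.μ (D.window n (M + R)) ≤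
      shannonEntropy D.μ (seqCoding D.T t (D.offsetFin r) N) +
        Real.log (D.ht n + D.L) + N * ε + R * Real.log D.L := by
  have hm1 : ∀ v, MeasurableSet (seqCoding D.T t (D.offsetFin r) N ⁻¹' {v}) :=
    measurableSet_preimage_pi fun k i => D.measurable_iterate_T _ (D.measurableSet_offsetFin r i)
  have hm2 := D.measurableSet_offsetFin n
  have hm3 : ∀ v, MeasurableSet ((fun x (k : Fin N) => D.edgeInfo r n t k x) ⁻¹' {v}) :=
    measurableSet_preimage_pi fun k i => D.measurableSet_edgeInfo r n t k i
  have hm4 : ∀ v, MeasurableSet ((fun x (i : Fin R) =>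
      (⟨D.gap n x (M + i), D.spacer_lt _⟩ : Fin D.L)) ⁻¹' {v}) :=
    measurableSet_preimage_pi fun k i => D.measurableSet_gapFin n _ i
  have hm12 := measurableSet_preimage_prodMk hm1 hm2
  have hm123 := measurableSet_preimage_prodMk hm12 hm3
  have hm1234 := measurableSet_preimage_prodMk hm123 hm4
  have hL : (0 : ℝ) < D.L := by exact_mod_cast D.L_pos
  calc shannonEntropy D.μ (D.window n (M + R)) ≤ _ :=
        shannonEntropy_le_of_factor hm1234 fun x y hxy => by
          simp only [Prod.mk.injEq] at hxy
          obtain ⟨⟨⟨h1, h2⟩, h3⟩, h4⟩ := hxy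
          have hobs : ∀ k < N, D.offset r (D.T^[t (k + 1)] x) = D.offset r (D.T^[t (k + 1)] y) :=
            fun k hk => congrArg Fin.val (congrFun h1 ⟨k, hk⟩)
          obtain ⟨i, hi, -, -, hz⟩ := (D.blockCoding n).decode (D.offsetFactor hrn) ht0 ht N hgap
            (congrArg Fin.val h2) hobs (fun k hk hb => by
              have h5 := congrFun h3 ⟨k, hk⟩
              have hbx : D.IsNearEnd r (D.T^[t (k + 1)] x) := hb
              have hby : D.IsNearEnd r (D.T^[t (k + 1)] y) := by
                unfold IsNearEnd at hbx ⊢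
                rwa [← hobs k hk]
              simp only [edgeInfo, if_pos hbx, if_pos hby] at h5
              exact congrArg Fin.val (Option.some_injective _ h5))
          -- With `i` towers left, the elapsed time is less than `(i + 1) * (D.ht n + D.L)`.
          have hMi : M < i + 1 := by
            have := (D.blockCoding n).lt_mul_of_crosses hi
            exact lt_of_mul_lt_mul_right (hM.trans_lt this) (Nat.zero_le _)
          funext l
          refine Fin.ext ?_
          change D.gap n x l = D.gap n y l
          rcases lt_or_ge l.1 M with hl | hl
          · exact hz l (by omega)
          · have := congrArg Fin.val (congrFun h4 ⟨l.1 - M, by omega⟩)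
            simpa [Nat.add_sub_cancel' hl] using this
    _ ≤ _ := shannonEntropy_prod_le hm123 hm4
    _ ≤ _ := add_le_add_left (shannonEntropy_prod_le hm12 hm3) _
    _ ≤ _ := add_le_add_left (add_le_add_left (shannonEntropy_prod_le hm1 hm2) _) _
    _ ≤ _ := by
        gcongr
        · refine (shannonEntropy_le_log_card hm2).trans (le_of_eq ?_)
          simp
        · refine (shannonEntropy_pi_le fun k i => D.measurableSet_edgeInfo r n t k i).trans ?_
          calc _ ≤ ∑ _k : Fin N, ε := Finset.sum_le_sum fun k _ => hε k
            _ = _ := by simp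
        · refine (shannonEntropy_le_log_card hm4).trans (le_of_eq ?_)
          simp

/-- By invariance the probability of being near an end is the same at all times, so `r` can be fixed
before `n` and `k`. -/
theorem exists_edgeInfo_le {ε : ℝ} (hε : 0 < ε) (t : ℕ → ℕ) :
    ∃ r, ∀ n k, shannonEntropy D.μ (D.edgeInfo r n t k) ≤ ε := by
  obtain ⟨δ, hδ, hsmall⟩ := exists_shannonEntropy_le (Option (Fin D.L)) hε
  obtain ⟨r, hr⟩ := (D.tendsto_isNearEnd.eventually_lt_const hδ).exists
  refine ⟨r, fun n k => hsmall D.μ _ none (D.measurableSet_edgeInfo r n t k) ?_⟩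
  have h1 := (D.measurePreserving_T.iterate (t (k + 1))).measureReal_preimage
    (D.measurable_ofPred_isNearEnd r).nullMeasurableSet
  refine le_trans (le_of_eq ?_) hr.le
  rw [← h1]
  congr 1
  ext x
  simp [edgeInfo]

/-- As long as the visits stay in one copy of the `(n + 1)`-st tower, the spacers are read off
consecutive columns. -/
theorem gap_eq {n i : ℕ} {x : D.Space}
    (h : res (D.E (n + 1)) x.1.1 / 2 ^ D.E n + 1 + i < D.q n) :
    D.gap n x i = D.a n (res (D.E (n + 1)) x.1.1 / 2 ^ D.E n + 1 + i) := by
  set m := res (D.E n) x.1.1 with hm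
  set z := x.1.1 - (m : ℤ_[2]) with hz
  have hE := (D.E_lt n).le
  have h0 : 0 < 2 ^ D.E n := by positivity
  obtain ⟨c, hc⟩ : 2 ^ D.E n ∣ res (D.E (n + 1)) z :=
    Nat.dvd_of_mod_eq_zero (by rw [res_mod hE, hz, hm, res_sub_res])
  have hcq : c < D.q n := by
    have hlt := res_lt (D.E (n + 1)) z
    rw [hc, two_pow_E_succ, mul_comm] at hlt
    exact lt_of_mul_lt_mul_right hlt (Nat.zero_le _)
  have hmlt : m < 2 ^ D.E n := res_lt _ _
  have hle : (c + 1) * 2 ^ D.E n ≤ 2 ^ D.E (n + 1) := by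
    rw [two_pow_E_succ]; exact Nat.mul_le_mul_right _ hcq
  have hx : res (D.E (n + 1)) x.1.1 = m + 2 ^ D.E n * c := by
    have : x.1.1 = z + (m : ℤ_[2]) := by rw [hz]; ring
    rw [this, res_add_natCast, hc, Nat.mod_eq_of_lt]
    · ring
    · calc 2 ^ D.E n * c + m < 2 ^ D.E n * c + 2 ^ D.E n := by omega
        _ = (c + 1) * 2 ^ D.E n := by ring
        _ ≤ _ := hle
  have hdiv : res (D.E (n + 1)) x.1.1 / 2 ^ D.E n = c := by
    rw [hx, Nat.add_mul_div_left _ _ h0, Nat.div_eq_of_lt hmlt, zero_add]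
  rw [hdiv] at h ⊢
  refine D.spacer_eq ?_ (by omega)
  rw [res_add_natCast, hc]
  have : 2 ^ D.E n * c + (i + 1) * 2 ^ D.E n = (c + 1 + i) * 2 ^ D.E n := by ring
  rw [this, Nat.mod_eq_of_lt]
  rw [two_pow_E_succ]
  exact Nat.mul_lt_mul_of_pos_right h h0

theorem haar2_digit_le (n : ℕ) (s : Finset ℕ) :
    haar2.real {w | res (D.E (n + 1)) w / 2 ^ D.E n ∈ s} ≤ s.card / D.q n := by
  classical
  have h0 : 0 < 2 ^ D.E n := by positivity
  set s' := (s ×ˢ Finset.range (2 ^ D.E n)).image fun p => p.1 * 2 ^ D.E n + p.2 with hs'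
  have hsub : {w | res (D.E (n + 1)) w / 2 ^ D.E n ∈ s} ⊆ {w | res (D.E (n + 1)) w ∈ s'} := by
    intro w hw
    refine Finset.mem_image.2 ⟨(res (D.E (n + 1)) w / 2 ^ D.E n, res (D.E (n + 1)) w % 2 ^ D.E n),
      ?_, ?_⟩
    · exact Finset.mem_product.2 ⟨hw, Finset.mem_range.2 (Nat.mod_lt _ h0)⟩
    · rw [mul_comm]; exact Nat.div_add_mod _ _
  have hcard : s'.card ≤ s.card * 2 ^ D.E n := by
    refine Finset.card_image_le.trans ?_
    rw [Finset.card_product, Finset.card_range]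
  refine (measureReal_mono hsub).trans ((haar2_res_mem_le _ _).trans ?_)
  have h2 : (2 : ℝ) ^ D.E (n + 1) = D.q n * 2 ^ D.E n := by exact_mod_cast D.two_pow_E_succ n
  have hq : (0 : ℝ) < D.q n := by have := D.two_le_q n; exact_mod_cast (by omega)
  rw [h2, div_le_div_iff₀ (by positivity) hq]
  have h3 : (s'.card : ℝ) ≤ s.card * 2 ^ D.E n := by exact_mod_cast hcard
  nlinarith

theorem measureReal_window_le {n K : ℕ} (hK : 0 < K)
    (ha : ∀ i, D.a n i = wordSeq D.L K i) (hq : K * D.L ^ K ≤ D.q n) (v : Fin K → Fin D.L) :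
    D.μ.real (D.window n K ⁻¹' {v}) ≤ D.L * (3 / D.L ^ K) := by
  classical
  let v' : ℕ → ℕ := fun i => if h : i < K then v ⟨i, h⟩ else 0
  let s₁ := (Finset.range (D.q n)).filter fun b => b + K < D.q n ∧
    ∀ i < K, wordSeq D.L K (b + 1 + i) = v' i
  -- From the last `K` columns the window may run out of the tower; they are counted as if they all
  -- showed `v`.
  let s := s₁ ∪ Finset.Ico (D.q n - K) (D.q n)
  have hL : (0 : ℝ) < D.L := by exact_mod_cast D.L_pos
  have hqpos : (0 : ℝ) < D.q n := by have := D.two_le_q n; exact_mod_cast (by omega)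
  have hsub : D.window n K ⁻¹' {v} ⊆
      {x | x.1.1 ∈ {w | res (D.E (n + 1)) w / 2 ^ D.E n ∈ s}} := by
    intro x hx
    have hx' : D.window n K x = v := hx
    have hlt : res (D.E (n + 1)) x.1.1 / 2 ^ D.E n < D.q n := by
      rw [Nat.div_lt_iff_lt_mul (by positivity), ← two_pow_E_succ]
      exact res_lt _ _
    have hgap : ∀ i, _ → D.gap n x i = _ := fun i => D.gap_eq (n := n) (i := i) (x := x)
    simp only [Set.mem_ofPred_eq, s, Finset.mem_union, Finset.mem_Ico, s₁, Finset.mem_filter,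
      Finset.mem_range]
    generalize res (D.E (n + 1)) x.1.1 / 2 ^ D.E n = b at hlt hgap ⊢
    rcases lt_or_ge (b + K) (D.q n) with h | h
    · left
      refine ⟨hlt, h, fun i hi => ?_⟩
      have h1 : D.gap n x i = (v ⟨i, hi⟩ : ℕ) := by rw [← hx']; rfl
      rw [← ha, ← hgap i (by omega), h1]
      simp [v', hi]
    · right; omega
  refine (measureReal_mono hsub).trans ((D.measureReal_base_le ?_).trans ?_)
  · exact ((measurable_from_top (f := fun m : ℕ => m / 2 ^ D.E n)).comp (measurable_res _))
      (Finset.measurableSet s)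
  refine mul_le_mul_of_nonneg_left ((D.haar2_digit_le n s).trans ?_) hL.le
  have hc1 : s₁.card ≤ K * (D.q n / (K * D.L ^ K) + 1) := by
    have h1 : (s₁.image fun b => b + 1).card = s₁.card :=
      Finset.card_image_of_injective _ (add_left_injective 1)
    rw [← h1]
    refine card_window_le hK v' _ fun c hc => ?_
    obtain ⟨b, hb, rfl⟩ := Finset.mem_image.1 hc
    obtain ⟨-, hb1, hb2⟩ := Finset.mem_filter.1 hb
    exact ⟨by omega, hb2⟩
  have hc2 : s.card ≤ K * (D.q n / (K * D.L ^ K) + 1) + K := by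
    refine (Finset.card_union_le _ _).trans (add_le_add hc1 ?_)
    rw [Nat.card_Ico]; omega
  -- One `D.q n` comes from complete periods; the incomplete period and the last `K` columns each
  -- contribute `K * D.L ^ K ≤ D.q n`.
  have hc3 : s.card * D.L ^ K ≤ 3 * D.q n := by
    calc s.card * D.L ^ K ≤ (K * (D.q n / (K * D.L ^ K) + 1) + K) * D.L ^ K :=
          Nat.mul_le_mul_right _ hc2
      _ = D.q n / (K * D.L ^ K) * (K * D.L ^ K) + 2 * (K * D.L ^ K) := by ring
      _ ≤ D.q n + 2 * D.q n := add_le_add (Nat.div_mul_le_self _ _) (Nat.mul_le_mul_left _ hq)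
      _ = 3 * D.q n := by ring
  rw [div_le_div_iff₀ hqpos (by positivity)]
  exact_mod_cast hc3

theorem le_shannonEntropy_window {n K : ℕ} (hK : 0 < K)
    (ha : ∀ i, D.a n i = wordSeq D.L K i) (hq : K * D.L ^ K ≤ D.q n) :
    K * Real.log D.L - Real.log (3 * D.L) ≤ shannonEntropy D.μ (D.window n K) := by
  have hL : (0 : ℝ) < D.L := by exact_mod_cast D.L_pos
  refine le_trans (le_of_eq ?_) (neg_log_le_shannonEntropy (D.measurableSet_window n K)
    (D.measureReal_window_le hK ha hq))
  rw [← mul_div_assoc, Real.log_div (by positivity) (by positivity), Real.log_pow, mul_comm 3]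
  ring

end Odo

/-! ### The choice of the parameters -/

/-- The exponent and the height of the `n`-th tower, when the spacers at a tower of height `h` are
placed according to `wordSeq L (κ h)`. -/
def towerParams (L : ℕ) (κ : ℕ → ℕ) : ℕ → ℕ × ℕ
  | 0 => (0, 1)
  | n + 1 =>
    let p := towerParams L κ n
    let e := Nat.clog 2 (κ p.2 * L ^ κ p.2)
    (p.1 + e, 2 ^ e * p.2 + ∑ i ∈ Finset.Ico 1 (2 ^ e), wordSeq L (κ p.2) i)

/-- The spacers of a stage depend on the height reached so far, so exponents and heights are defined
by a joint recursion and the latter are then identified with `D.ht`. Rounding the number of columns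
up to a power of two costs at most a factor `2`. -/
theorem exists_odo {L : ℕ} (hL : 2 ≤ L) {κ : ℕ → ℕ} (hκ : ∀ h, 0 < κ h) :
    ∃ D : Odo, D.L = L ∧ (∀ n i, D.a n i = wordSeq D.L (κ (D.ht n)) i) ∧
      (∀ n, κ (D.ht n) * D.L ^ κ (D.ht n) ≤ D.q n) ∧
      ∀ n, D.q n ≤ 2 * (κ (D.ht n) * D.L ^ κ (D.ht n)) := by
  have htwo : ∀ h, 2 ≤ κ h * L ^ κ h := fun h =>
    calc 2 ≤ L := hL
      _ ≤ L ^ κ h := Nat.le_self_pow (hκ h).ne' L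
      _ ≤ κ h * L ^ κ h := Nat.le_mul_of_pos_left _ (hκ h)
  have hclog : ∀ h, 0 < Nat.clog 2 (κ h * L ^ κ h) := fun h =>
    Nat.clog_pos one_lt_two (htwo h)
  let D : Odo :=
    { E := fun n => (towerParams L κ n).1
      a := fun n i => wordSeq L (κ (towerParams L κ n).2) i
      L := L
      E_zero := rfl
      E_lt := fun n => Nat.lt_add_of_pos_right (hclog _)
      L_pos := by omega
      a_lt := fun n i => Nat.mod_lt _ (by omega) }
  have hq : ∀ n, D.q n = 2 ^ Nat.clog 2 (κ (towerParams L κ n).2 * L ^ κ (towerParams L κ n).2) := by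
    intro n
    change 2 ^ ((towerParams L κ n).1 + _ - (towerParams L κ n).1) = _
    rw [Nat.add_sub_cancel_left]
  have hht : ∀ n, D.ht n = (towerParams L κ n).2 := by
    intro n
    induction n with
    | zero => exact D.ht_zero
    | succ n ih =>
      rw [D.ht_succ, ih, hq]
      rfl
  refine ⟨D, rfl, fun n i => ?_, fun n => ?_, fun n => ?_⟩
  · rw [hht]
  · rw [hht, hq]
    exact Nat.le_pow_clog one_lt_two _
  · rw [hht, hq]
    have h1 := Nat.pow_pred_clog_lt_self one_lt_two (htwo (towerParams L κ n).2)
    have h2 := hclog (towerParams L κ n).2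
    obtain ⟨k, hk⟩ := Nat.exists_eq_add_of_lt h2
    rw [hk] at h1 ⊢
    simp only [zero_add, Nat.pred_succ] at h1 ⊢
    change _ ≤ 2 * (κ (towerParams L κ n).2 * L ^ κ (towerParams L κ n).2)
    rw [pow_succ]
    omega

/-! ### Asymptotics -/

theorem eventually_log_le {β : ℝ} (hβ : 0 < β) (a b : ℝ) {η : ℝ} (hη : 0 < η) :
    ∀ᶠ h : ℝ in atTop, a + b * Real.log h ≤ η * h ^ β := by
  have h1 : Tendsto (fun h : ℝ => Real.log h / h ^ β) atTop (nhds 0) :=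
    (isLittleO_log_rpow_atTop hβ).tendsto_div_nhds_zero
  have h2 : Tendsto (fun h : ℝ => a / h ^ β) atTop (nhds 0) :=
    tendsto_const_nhds.div_atTop (tendsto_rpow_atTop hβ)
  have h3 : Tendsto (fun h : ℝ => a / h ^ β + b * (Real.log h / h ^ β)) atTop (nhds 0) := by
    simpa using h2.add (h1.const_mul b)
  filter_upwards [h3.eventually_lt_const hη, eventually_gt_atTop 0] with h hh h0
  have hpos : 0 < h ^ β := Real.rpow_pos_of_pos h0 β
  have : a / h ^ β + b * (Real.log h / h ^ β) = (a + b * Real.log h) / h ^ β := by ring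
  rw [this, div_lt_iff₀ hpos] at hh
  exact hh.le

theorem log_add_le {h L : ℝ} (hh : 1 ≤ h) (hL : 0 ≤ L) :
    Real.log (h + L) ≤ Real.log (1 + L) + Real.log h := by
  rw [← Real.log_mul (by positivity) (by positivity)]
  exact Real.log_le_log (by positivity) (by nlinarith)

/-- Bernoulli's inequality for `(1 - 1 / (k + 1)) ^ α`; it bounds the gaps between observation
times. -/
theorem rpow_add_one_le {α : ℝ} (hα : 1 ≤ α) (k : ℕ) :
    ((k : ℝ) + 1) ^ α ≤ (k : ℝ) ^ α + α * ((k : ℝ) + 1) ^ (α - 1) := by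
  have hk : (0 : ℝ) < (k : ℝ) + 1 := by positivity
  have h1 := one_add_mul_self_le_rpow_one_add (s := -1 / ((k : ℝ) + 1)) (p := α)
    (by rw [le_div_iff₀ hk]; linarith [(Nat.cast_nonneg k : (0 : ℝ) ≤ k)]) hα
  have h2 : 1 + -1 / ((k : ℝ) + 1) = k / ((k : ℝ) + 1) := by field_simp; ring
  rw [h2, Real.div_rpow (Nat.cast_nonneg k) hk.le, le_div_iff₀ (by positivity)] at h1
  have h3 : ((k : ℝ) + 1) ^ α = ((k : ℝ) + 1) * ((k : ℝ) + 1) ^ (α - 1) := by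
    rw [← Real.rpow_one_add' hk.le (by linarith)]
    congr 1; ring
  have h4 : (1 + α * (-1 / ((k : ℝ) + 1))) * ((k : ℝ) + 1) ^ α =
      ((k : ℝ) + 1) ^ α - α * ((k : ℝ) + 1) ^ (α - 1) := by
    rw [h3]; field_simp; ring
  linarith

/-- A rank one system of the construction whose spacers at height `h` follow the words of length
`⌈C ^ (1 + β) * h ^ β⌉`. -/
structure Odo.HasRate (D : Odo) (β C : ℝ) : Prop where
  two_le : 2 ≤ D.L
  β_pos : 0 < β
  C_pos : 0 < C
  a_eq : ∀ n i, D.a n i = wordSeq D.L ⌈C * (C * D.ht n) ^ β⌉₊ i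
  le_q : ∀ n, ⌈C * (C * D.ht n) ^ β⌉₊ * D.L ^ ⌈C * (C * D.ht n) ^ β⌉₊ ≤ D.q n
  q_le : ∀ n, D.q n ≤ 2 * (⌈C * (C * D.ht n) ^ β⌉₊ * D.L ^ ⌈C * (C * D.ht n) ^ β⌉₊)

theorem exists_hasRate {L : ℕ} (hL : 2 ≤ L) {β C : ℝ} (hβ : 0 < β) (hC : 0 < C) :
    ∃ D : Odo, D.L = L ∧ D.HasRate β C := by
  -- The maximum makes the length positive also at `h = 0`, which is not the height of a tower.
  obtain ⟨D, h0, h1, h2, h3⟩ := exists_odo hL (κ := fun h => max 1 ⌈C * (C * h) ^ β⌉₊)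
    (fun h => by simp)
  have hmax : ∀ n, max 1 ⌈C * (C * D.ht n) ^ β⌉₊ = ⌈C * (C * D.ht n) ^ β⌉₊ := by
    intro n
    refine max_eq_right (Nat.succ_le_of_lt (Nat.ceil_pos.2 ?_))
    have : (0 : ℝ) < D.ht n := by exact_mod_cast D.ht_pos n
    positivity
  simp only [hmax] at h1 h2 h3
  exact ⟨D, h0, h0 ▸ hL, hβ, hC, h1, h2, h3⟩

/-! ### Growth of the heights and the upper bound -/

namespace Odo

variable {D : Odo} {β C : ℝ}

theorem tendsto_ht (D : Odo) : Tendsto (fun n => (D.ht n : ℝ)) atTop atTop :=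
  tendsto_atTop_mono (fun n => by exact_mod_cast D.two_pow_le_ht n) D.tendsto_two_pow_E

theorem one_le_ht (D : Odo) (n : ℕ) : (1 : ℝ) ≤ D.ht n := by exact_mod_cast D.ht_pos n

theorem ht_succ_le (D : Odo) (n : ℕ) : D.ht (n + 1) ≤ D.q n * (D.ht n + D.L) := by
  rw [ht_succ, mul_add]
  gcongr
  calc _ ≤ ∑ _i ∈ Finset.Ico 1 (D.q n), D.L := Finset.sum_le_sum fun i _ => (D.a_lt n i).le
    _ ≤ _ := by
      rw [Finset.sum_const, Nat.card_Ico, smul_eq_mul]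
      exact Nat.mul_le_mul_right _ (Nat.sub_le _ _)

/-- The next height is at most about `2 * K * L ^ K * (h + L)`. The factor `L ^ K` gives the main
term; `K`, of order `h ^ β`, and `h` itself contribute `(β + 1) * log h`. -/
theorem HasRate.log_ht_succ_le (hD : D.HasRate β C) :
    ∃ B : ℝ, ∀ n, Real.log (D.ht (n + 1) + D.L) ≤
      C * (C * D.ht n) ^ β * Real.log D.L + (B + (β + 1) * Real.log (D.ht n)) := by
  have hβ := hD.β_pos
  have hC := hD.C_pos
  have hL : (2 : ℝ) ≤ D.L := by exact_mod_cast hD.two_le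
  have hlogL : 0 ≤ Real.log D.L := Real.log_nonneg (by linarith)
  refine ⟨Real.log (4 * (C * C ^ β + 1) * (1 + D.L)) + Real.log D.L, fun n => ?_⟩
  set h : ℝ := (D.ht n : ℝ) with hh
  have h1 : 1 ≤ h := D.one_le_ht n
  have hhβ : 1 ≤ h ^ β := Real.one_le_rpow h1 hβ.le
  set K := ⌈C * (C * h) ^ β⌉₊ with hK
  have hKle : (K : ℝ) ≤ C * (C * h) ^ β + 1 := (Nat.ceil_lt_add_one (by positivity)).le
  have hKle2 : (K : ℝ) ≤ (C * C ^ β + 1) * h ^ β := by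
    refine hKle.trans ?_
    rw [Real.mul_rpow hC.le (by linarith)]
    nlinarith
  have hKpos : (1 : ℝ) ≤ K := by
    have : 0 < K := Nat.ceil_pos.2 (by positivity)
    exact_mod_cast this
  have hq : (D.q n : ℝ) ≤ 2 * (K * (D.L : ℝ) ^ K) := by exact_mod_cast hD.q_le n
  have hLK : (1 : ℝ) ≤ (D.L : ℝ) ^ K := one_le_pow₀ (by linarith)
  have hmain : (D.ht (n + 1) + D.L : ℝ) ≤
      (D.L : ℝ) ^ K * (4 * (C * C ^ β + 1) * (1 + D.L) * (h ^ β * h)) := by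
    have h2 : (D.ht (n + 1) : ℝ) ≤ D.q n * (h + D.L) := by
      rw [hh]; exact_mod_cast D.ht_succ_le n
    have h3 : h + D.L ≤ (1 + D.L) * h := by nlinarith
    have hKL : 1 ≤ (K : ℝ) * (D.L : ℝ) ^ K := one_le_mul_of_one_le_of_one_le hKpos hLK
    calc (D.ht (n + 1) + D.L : ℝ) ≤ D.q n * (h + D.L) + D.L := by linarith
      _ ≤ 2 * (K * (D.L : ℝ) ^ K) * (h + D.L) + 2 * (K * (D.L : ℝ) ^ K) * (h + D.L) := by
          refine add_le_add (mul_le_mul_of_nonneg_right hq (by linarith)) ?_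
          nlinarith
      _ = (D.L : ℝ) ^ K * (4 * K * (h + D.L)) := by ring
      _ ≤ (D.L : ℝ) ^ K * (4 * ((C * C ^ β + 1) * h ^ β) * ((1 + D.L) * h)) := by gcongr
      _ = _ := by ring
  have hB : 0 < 4 * (C * C ^ β + 1) * (1 + D.L : ℝ) := by positivity
  calc Real.log (D.ht (n + 1) + D.L) ≤ _ := Real.log_le_log (by positivity) hmain
    _ = K * Real.log D.L + (Real.log (4 * (C * C ^ β + 1) * (1 + D.L)) +
        (β * Real.log h + Real.log h)) := by
        rw [Real.log_mul (by positivity) (by positivity), Real.log_pow,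
          Real.log_mul hB.ne' (by positivity), Real.log_mul (x := h ^ β) (by positivity)
            (by positivity), Real.log_rpow (by linarith)]
    _ ≤ _ := by
        have := mul_le_mul_of_nonneg_right hKle hlogL
        linarith

/-- For every large `N` some tower is well adapted to the first `N` observation times. -/
theorem HasRate.eventually_exists_tower (hD : D.HasRate β C) {α : ℝ} (hα : α = 1 + 1 / β)
    (r : ℕ) {ε : ℝ} (hε : 0 < ε) :
    ∀ᶠ N : ℕ in atTop, ∃ n ≥ r, ∃ W : ℕ, D.ht n + D.L + ⌊(N : ℝ) ^ α⌋₊ ≤ W * D.ht n ∧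
      Real.log (D.ht n + D.L) + W * Real.log D.L ≤ N * (C * Real.log D.L + ε) := by
  have hβ := hD.β_pos
  have hC := hD.C_pos
  have hL : (2 : ℝ) ≤ D.L := by exact_mod_cast hD.two_le
  have hlogL : 0 < Real.log D.L := Real.log_pos (by linarith)
  obtain ⟨B, hB⟩ := hD.log_ht_succ_le
  set δ := ε / (4 * Real.log D.L) with hδ
  have hδ0 : 0 < δ := by positivity
  have hε4 : 0 < ε / 4 := by positivity
  have e1 := D.tendsto_ht.eventually
    (eventually_log_le hβ B (β + 1) (η := ε / 4 * C ^ β) (by positivity))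
  have e2 := D.tendsto_ht.eventually
    (eventually_log_le hβ (Real.log (1 + D.L)) 1 (η := ε / 4 * δ ^ β) (by positivity))
  obtain ⟨n₁, hn₁⟩ := eventually_atTop.1 (e1.and e2)
  set n₀ := max n₁ r with hn₀
  have hNlarge : ∀ᶠ N : ℕ in atTop,
      (∀ p ∈ Finset.range (n₀ + 1), (C * D.ht p) ^ β < (N : ℝ)) ∧
        (2 + D.L) * Real.log D.L / (ε / 4) ≤ (N : ℝ) := by
    refine ((Finset.eventually_all _).2 fun p _ => ?_).and ?_
    · exact tendsto_natCast_atTop_atTop.eventually_gt_atTop _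
    · exact tendsto_natCast_atTop_atTop.eventually_ge_atTop _
  filter_upwards [hNlarge, eventually_ge_atTop 1] with N hN hN1
  obtain ⟨hNp, hNL⟩ := hN
  have hN0 : (0 : ℝ) < N := by exact_mod_cast hN1
  have hex : ∃ n, (N : ℝ) ≤ (C * D.ht n) ^ β := by
    have : Tendsto (fun n => (C * D.ht n) ^ β) atTop atTop :=
      (tendsto_rpow_atTop hβ).comp (D.tendsto_ht.const_mul_atTop hC)
    exact (this.eventually_ge_atTop _).exists
  classical
  -- Minimality of `n` bounds the previous height from above in terms of `N`, hence also `log (D.ht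
  -- n)`.
  set n := Nat.find hex with hn
  have hnspec : (N : ℝ) ≤ (C * D.ht n) ^ β := Nat.find_spec hex
  have hn0 : n₀ < n := by
    by_contra! h
    exact (hNp n (Finset.mem_range.2 (by omega))).not_ge hnspec
  obtain ⟨p, hp⟩ := Nat.exists_eq_add_of_lt hn0
  have hpmin : (C * D.ht (n₀ + p)) ^ β < N := not_le.1 (Nat.find_min hex (by omega))
  refine ⟨n, by omega, ⌊(N : ℝ) ^ α⌋₊ / D.ht n + 2 + D.L, ?_, ?_⟩
  · have h1 := Nat.lt_div_mul_add (D.ht_pos n) (a := ⌊(N : ℝ) ^ α⌋₊)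
    have h2 : D.L ≤ D.L * D.ht n := Nat.le_mul_of_pos_right _ (D.ht_pos n)
    calc _ ≤ D.ht n + D.L * D.ht n + (⌊(N : ℝ) ^ α⌋₊ / D.ht n * D.ht n + D.ht n) := by
          omega
      _ = _ := by ring
  · set h : ℝ := (D.ht n : ℝ) with hh
    have h1 : 1 ≤ h := D.one_le_ht n
    have hW : ((⌊(N : ℝ) ^ α⌋₊ / D.ht n + 2 + D.L : ℕ) : ℝ) ≤
        N * ((N : ℝ) ^ (1 / β) / h) + (2 + D.L) := by
      push_cast
      have h2 : ((⌊(N : ℝ) ^ α⌋₊ / D.ht n : ℕ) : ℝ) ≤ (N : ℝ) ^ α / h :=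
        Nat.cast_div_le.trans (div_le_div_of_nonneg_right
          (Nat.floor_le (by positivity)) (by linarith))
      have h3 : (N : ℝ) ^ α = N * (N : ℝ) ^ (1 / β) := by
        rw [hα, Real.rpow_add hN0, Real.rpow_one]
      have h4 : (N : ℝ) ^ α / h = N * ((N : ℝ) ^ (1 / β) / h) := by rw [h3, mul_div_assoc]
      linarith
    have hW2 : ((⌊(N : ℝ) ^ α⌋₊ / D.ht n + 2 + D.L : ℕ) : ℝ) * Real.log D.L ≤
        N * ((N : ℝ) ^ (1 / β) / h * Real.log D.L) + N * (ε / 4) := by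
      have h2 := mul_le_mul_of_nonneg_right hW hlogL.le
      rw [div_le_iff₀ hε4] at hNL
      linarith
    have hroot : ∀ {x : ℝ}, 0 ≤ x → (N : ℝ) ≤ (x * h) ^ β → (N : ℝ) ^ (1 / β) / h ≤ x := by
      intro x hx hNx
      rw [div_le_iff₀ (by linarith)]
      calc (N : ℝ) ^ (1 / β) ≤ ((x * h) ^ β) ^ (1 / β) :=
            Real.rpow_le_rpow hN0.le hNx (by positivity)
        _ = x * h := by
            rw [← Real.rpow_mul (by positivity), mul_one_div_cancel hβ.ne', Real.rpow_one]
    -- In the first case the main contribution is the starting level and the spacer numbers are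
    -- negligible; in the second the roles are exchanged.
    rcases le_or_gt (N : ℝ) ((δ * h) ^ β) with hcase | hcase
    · have h2 := hroot hδ0.le hcase
      have h3 : (N : ℝ) ^ (1 / β) / h * Real.log D.L ≤ ε / 4 := by
        calc _ ≤ δ * Real.log D.L := mul_le_mul_of_nonneg_right h2 hlogL.le
          _ = ε / 4 := by rw [hδ]; field_simp
      have h4 := mul_le_mul_of_nonneg_left h3 hN0.le
      have h5 : Real.log (h + D.L) ≤ N * (C * Real.log D.L + ε / 4) := by
        have hnp : n = (n₀ + p) + 1 := by omega
        have h6 := hB (n₀ + p)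
        rw [← hnp] at h6
        refine h6.trans ?_
        have h7 := (hn₁ (n₀ + p) (by omega)).1
        have h8 : ε / 4 * C ^ β * (D.ht (n₀ + p) : ℝ) ^ β = ε / 4 * (C * D.ht (n₀ + p)) ^ β := by
          rw [Real.mul_rpow hC.le (by positivity)]; ring
        have h9 := mul_le_mul_of_nonneg_right hpmin.le
          (by positivity : 0 ≤ C * Real.log D.L + ε / 4)
        rw [h8] at h7
        linarith
      have h6 : 0 ≤ N * (ε / 4) := by positivity
      linarith
    · have h2 := mul_le_mul_of_nonneg_right (hroot hC.le hnspec) hlogL.le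
      have h3 := mul_le_mul_of_nonneg_left h2 hN0.le
      have h4 : Real.log (h + D.L) ≤ N * (ε / 4) := by
        have h5 := (hn₁ n (by omega)).2
        rw [mul_assoc, ← Real.mul_rpow hδ0.le (by positivity)] at h5
        have h6 := mul_le_mul_of_nonneg_left hcase.le hε4.le
        have h7 := log_add_le h1 (by linarith : (0 : ℝ) ≤ D.L)
        linarith
      have h6 : 0 ≤ N * (ε / 4) := by positivity
      linarith

theorem HasRate.seqEntropy_le (hD : D.HasRate β C) {α : ℝ} (hα : α = 1 + 1 / β)
    {t : ℕ → ℕ} (ht : ∀ n : ℕ, t n = ⌊(n : ℝ) ^ α⌋₊) (hmono : Monotone t) :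
    seqEntropy D.μ D.T t ≤ ((C * Real.log D.L : ℝ) : EReal) := by
  refine iSup_le fun m => iSup_le fun φ => iSup_le fun hφ => ?_
  by_contra! hlt
  obtain ⟨y, hy1, hy2⟩ := EReal.lt_iff_exists_real_btwn.1 hlt
  rw [EReal.coe_lt_coe_iff] at hy1
  -- One `ε` pays for replacing the partition by one into levels, the other for the estimate along
  -- towers.
  set ε := (y - C * Real.log D.L) / 2 with hε
  have hε0 : 0 < ε := by rw [hε]; linarith
  obtain ⟨r, g, hg⟩ := D.exists_shannonEntropy_seqCoding_le hφ t hε0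
  refine hy2.not_ge (limsup_le_of_le (by isBoundedDefault) ?_)
  filter_upwards [hD.eventually_exists_tower hα r hε0, eventually_ge_atTop 1] with N hN hN1
  obtain ⟨n, hn, W, hW, hlog⟩ := hN
  rw [EReal.coe_le_coe_iff]
  have hN0 : (0 : ℝ) < N := by exact_mod_cast hN1
  rw [← ht] at hW
  have h1 := (hg N).trans (add_le_add_left
    ((D.shannonEntropy_seqCoding_offset_le g hn hmono hW).trans hlog) _)
  rw [one_div, inv_mul_le_iff₀ hN0]
  refine h1.trans (le_of_eq ?_)
  rw [hε]; ring

end Odo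

/-! ### Adapted observation times and the lower bound -/

theorem tendsto_floor_mul_rpow_div {β a : ℝ} (hβ : 0 < β) (ha : 0 ≤ a) :
    Tendsto (fun h : ℝ => (⌊a * h ^ β⌋₊ : ℝ) / h ^ β) atTop (nhds a) :=
  (tendsto_nat_floor_mul_div_atTop ha).comp (tendsto_rpow_atTop hβ)

theorem tendsto_floor_rpow_div {β v : ℝ} (hβ : 0 < β) (hv : 0 < v) (L : ℝ) :
    Tendsto (fun h : ℝ => (⌊v ^ β * h ^ β⌋₊ : ℝ) ^ (1 / β) / (h + L)) atTop (nhds v) := by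
  have h1 : Tendsto (fun h : ℝ => ((⌊v ^ β * h ^ β⌋₊ : ℝ) / h ^ β) ^ (1 / β)) atTop (nhds v) := by
    have h2 := (tendsto_floor_mul_rpow_div hβ (by positivity : 0 ≤ v ^ β)).rpow_const
      (p := 1 / β) (Or.inr (by positivity))
    rwa [← Real.rpow_mul hv.le, mul_one_div_cancel hβ.ne', Real.rpow_one] at h2
  have h3 : Tendsto (fun h : ℝ => (1 + L / h)⁻¹) atTop (nhds 1) := by
    have : Tendsto (fun h : ℝ => L / h) atTop (nhds 0) := tendsto_const_nhds.div_atTop tendsto_id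
    simpa using (this.const_add 1).inv₀ (by norm_num)
  have h4 := h1.mul h3
  rw [mul_one] at h4
  refine h4.congr' ?_
  filter_upwards [eventually_gt_atTop 0] with h hh
  rw [Real.div_rpow (Nat.cast_nonneg _) (by positivity), ← Real.rpow_mul hh.le,
    mul_one_div_cancel hβ.ne', Real.rpow_one]
  have h5 : (1 + L / h)⁻¹ = h / (h + L) := by
    rw [← inv_div]; field_simp
  rw [h5]
  field_simp

/-- Up to index `(v * h) ^ β` the gaps are at most `α * (v * h) + 1`, as `α - 1 = 1 / β`. This is
the gap condition needed for decoding. -/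
theorem floor_rpow_succ_le {α β v h : ℝ} (hβ : 0 < β) (hα : α = 1 + 1 / β) (hv : 0 < v) (hh : 0 < h)
    {H : ℕ} (hH : α * v * h + 1 ≤ H) {k : ℕ} (hk : k < ⌊v ^ β * h ^ β⌋₊) :
    ⌊((k + 1 : ℕ) : ℝ) ^ α⌋₊ ≤ ⌊(k : ℝ) ^ α⌋₊ + H := by
  have hα1 : 1 ≤ α := by rw [hα]; linarith [one_div_pos.2 hβ]
  have h1 := rpow_add_one_le hα1 k
  have h2 : ((k : ℝ) + 1) ^ (α - 1) ≤ v * h := by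
    have h3 : ((k : ℝ) + 1) ≤ (v * h) ^ β := by
      rw [Real.mul_rpow hv.le hh.le]
      refine le_trans ?_ (Nat.floor_le (by positivity))
      exact_mod_cast hk
    calc ((k : ℝ) + 1) ^ (α - 1) ≤ ((v * h) ^ β) ^ (α - 1) :=
          Real.rpow_le_rpow (by positivity) h3 (by linarith)
      _ = v * h := by
          rw [← Real.rpow_mul (by positivity), hα, add_sub_cancel_left,
            mul_one_div_cancel hβ.ne', Real.rpow_one]
  have h3 : α * ((k : ℝ) + 1) ^ (α - 1) ≤ α * (v * h) :=
    mul_le_mul_of_nonneg_left h2 (by linarith)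
  have h4 : (k : ℝ) ^ α < ⌊(k : ℝ) ^ α⌋₊ + 1 := Nat.lt_floor_add_one _
  refine Nat.floor_le_of_le ?_
  push_cast
  linarith

namespace Odo

variable {D : Odo} {β C : ℝ}

theorem HasRate.eventually_le_shannonEntropy (hD : D.HasRate β C) {α : ℝ} (hα : α = 1 + 1 / β)
    (hαC : α * C ≤ 1) {t : ℕ → ℕ} (ht : ∀ n : ℕ, t n = ⌊(n : ℝ) ^ α⌋₊) (hmono : Monotone t)
    {y : ℝ} (hy : y < C * Real.log D.L) :
    ∃ r, ∃ N : ℕ → ℕ, Tendsto N atTop atTop ∧ ∀ᶠ n in atTop,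
      N n * y ≤ shannonEntropy D.μ (seqCoding D.T t (D.offsetFin r) (N n)) := by
  have hβ := hD.β_pos
  have hC := hD.C_pos
  have hL : (2 : ℝ) ≤ D.L := by exact_mod_cast hD.two_le
  have hlogL : 0 < Real.log D.L := Real.log_pos (by linarith)
  have hα0 : 0 < α := by rw [hα]; positivity
  set d := C * Real.log D.L - y with hd
  have hd0 : 0 < d := by rw [hd]; linarith
  -- The deficit `d` is spent in quarters: two on replacing `C` by `v - η`, one on the logarithmic
  -- terms, one on the edge records.
  set η := d / (4 * Real.log D.L) with hη
  have hη0 : 0 < η := by positivity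
  have hηL : η * Real.log D.L = d / 4 := by rw [hη]; field_simp
  -- Taking `v` strictly below `C` gives `α * v < 1`, which leaves room for the rounding in the gap
  -- condition.
  set v := max (C / 2) (C - η) with hv
  have hv0 : 0 < v := lt_of_lt_of_le (by positivity) (le_max_left _ _)
  have hvC : v < C := max_lt (by linarith) (by linarith)
  have hvη : C - η ≤ v := le_max_right _ _
  have hvβ : 0 < v ^ β := by positivity
  obtain ⟨r, hr⟩ := D.exists_edgeInfo_le (by positivity : 0 < d / 4) t
  set Nf : ℝ → ℕ := fun h => ⌊v ^ β * h ^ β⌋₊ with hNf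
  have hNf_top : Tendsto Nf atTop atTop :=
    tendsto_nat_floor_atTop.comp ((tendsto_rpow_atTop hβ).const_mul_atTop hvβ)
  refine ⟨r, fun n => Nf (D.ht n), hNf_top.comp D.tendsto_ht, ?_⟩
  have e1 : ∀ᶠ h : ℝ in atTop, v - η / 2 < (Nf h : ℝ) ^ (1 / β) / (h + D.L) :=
    (tendsto_floor_rpow_div hβ hv0 D.L).eventually_const_lt (by linarith)
  have e2 : ∀ᶠ h : ℝ in atTop, 4 / η ≤ Nf h :=
    (tendsto_natCast_atTop_atTop.comp hNf_top).eventually_ge_atTop _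
  have e3 : ∀ᶠ h : ℝ in atTop, v ^ β / 2 < (Nf h : ℝ) / h ^ β :=
    (tendsto_floor_mul_rpow_div hβ hvβ.le).eventually_const_lt (by linarith)
  have e4 := eventually_log_le hβ (Real.log (3 * D.L) + Real.log (1 + D.L)) 1
    (η := d / 4 * (v ^ β / 2)) (by positivity)
  have hαv : 0 < 1 - α * v := by linarith [mul_lt_mul_of_pos_left hvC hα0]
  have e5 : ∀ᶠ h : ℝ in atTop, 1 / (1 - α * v) ≤ h := eventually_ge_atTop _
  filter_upwards [D.tendsto_ht.eventually (e1.and (e2.and (e3.and (e4.and e5)))),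
    eventually_ge_atTop r] with n hn hrn
  obtain ⟨h1, h2, h3, h4, h5⟩ := hn
  set h : ℝ := (D.ht n : ℝ) with hh
  have hh1 : 1 ≤ h := D.one_le_ht n
  set N := Nf h with hN
  set K := ⌈C * (C * h) ^ β⌉₊ with hK
  set M := t N / (D.ht n + D.L) with hM
  have hK0 : 0 < K := Nat.ceil_pos.2 (by positivity)
  have hN0 : (0 : ℝ) < N := lt_of_lt_of_le (by positivity) h2
  have hhL : 0 < h + D.L := by linarith
  have hNα : (N : ℝ) ^ α = N * (N : ℝ) ^ (1 / β) := by
    rw [hα, Real.rpow_add hN0, Real.rpow_one]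
  have hNle : (N : ℝ) ≤ (v * h) ^ β := by
    rw [Real.mul_rpow hv0.le (by linarith)]
    exact Nat.floor_le (by positivity)
  have hroot : (N : ℝ) ^ (1 / β) ≤ v * h := by
    calc (N : ℝ) ^ (1 / β) ≤ ((v * h) ^ β) ^ (1 / β) :=
          Real.rpow_le_rpow hN0.le hNle (by positivity)
      _ = v * h := by
          rw [← Real.rpow_mul (by positivity), mul_one_div_cancel hβ.ne', Real.rpow_one]
  have htle : (t N : ℝ) ≤ N * (N : ℝ) ^ (1 / β) := by
    rw [ht, ← hNα]; exact Nat.floor_le (by positivity)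
  have htge : N * (N : ℝ) ^ (1 / β) - 1 ≤ t N := by
    rw [ht, ← hNα]; exact (Nat.sub_one_lt_floor _).le
  -- About `v * N ≤ v * (v * h) ^ β` towers are passed, no more than the length of the words.
  have hMK : M ≤ K := by
    have h6 : (M : ℝ) ≤ C * (C * h) ^ β := by
      calc (M : ℝ) ≤ (t N : ℝ) / (h + D.L) := by
            refine Nat.cast_div_le.trans (le_of_eq ?_)
            push_cast; rfl
        _ ≤ (t N : ℝ) / h := by gcongr; linarith
        _ ≤ v * (v * h) ^ β := by
            rw [div_le_iff₀ (by linarith)]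
            calc (t N : ℝ) ≤ N * (N : ℝ) ^ (1 / β) := htle
              _ ≤ (v * h) ^ β * (v * h) := by gcongr
              _ = _ := by ring
        _ ≤ C * (C * h) ^ β := by gcongr
    exact_mod_cast h6.trans (Nat.le_ceil _)
  -- The two roundings, in `t N` and in the quotient `M`, lose at most `2`, which `N * η / 2`
  -- absorbs by `h2`.
  have hMge : (v - η) * N ≤ M := by
    have h6 : (t N : ℝ) < (M + 1) * (h + D.L) := by
      have h7 := Nat.lt_div_mul_add (a := t N) (b := D.ht n + D.L)
        (Nat.lt_of_lt_of_le (D.ht_pos n) (Nat.le_add_right _ _))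
      rw [hh]
      have h8 : t N < (M + 1) * (D.ht n + D.L) := by rw [add_mul, one_mul]; exact h7
      exact_mod_cast h8
    rw [lt_div_iff₀ hhL] at h1
    rw [div_le_iff₀ hη0] at h2
    have h7 : N * ((v - η / 2) * (h + D.L)) ≤ N * (N : ℝ) ^ (1 / β) :=
      mul_le_mul_of_nonneg_left h1.le hN0.le
    have h8 : (h + D.L) * (N * (v - η / 2)) < (h + D.L) * (M + 2) := by
      have e : (h + D.L) * (N * (v - η / 2)) = N * ((v - η / 2) * (h + D.L)) := by ring
      have e' : (h + D.L) * ((M : ℝ) + 2) = (M + 1) * (h + D.L) + (h + D.L) := by ring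
      linarith
    have h9 := lt_of_mul_lt_mul_left h8 hhL.le
    have e : (v - η) * N = N * (v - η / 2) - N * η / 2 := by ring
    linarith
  have hlogs : Real.log (3 * D.L) + Real.log (h + D.L) ≤ N * (d / 4) := by
    have h6 := log_add_le hh1 (by linarith : (0 : ℝ) ≤ D.L)
    rw [lt_div_iff₀ (by positivity)] at h3
    have h7 := mul_le_mul_of_nonneg_left h3.le (by positivity : 0 ≤ d / 4)
    linarith
  have hgap : ∀ k < N, t (k + 1) ≤ t k + D.ht n := by
    intro k hk
    rw [ht, ht]
    refine floor_rpow_succ_le hβ hα hv0 (by linarith : 0 < h) ?_ hk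
    rw [div_le_iff₀ hαv] at h5
    linarith
  have ht0 : t 0 = 0 := by rw [ht]; simp [Real.zero_rpow hα0.ne']
  have hwin := D.le_shannonEntropy_window hK0 (hD.a_eq n) (hD.le_q n)
  have hup := D.shannonEntropy_window_le hrn ht0 hmono (N := N) (M := M) (R := K - M) hgap
    (Nat.div_mul_le_self _ _) (hr n)
  rw [Nat.add_sub_cancel' hMK, Nat.cast_sub hMK] at hup
  have h6 := mul_le_mul_of_nonneg_right hMge hlogL.le
  have h7 : (C - η - η) * N * Real.log D.L ≤ (v - η) * N * Real.log D.L := by gcongr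
  have h8 : (C - η - η) * N * Real.log D.L = N * (C * Real.log D.L) - N * (d / 4) - N * (d / 4) := by
    rw [← hηL]; ring
  have h9 : N * y = N * (C * Real.log D.L) - N * d := by rw [hd]; ring
  linarith

theorem HasRate.le_seqEntropy (hD : D.HasRate β C) {α : ℝ} (hα : α = 1 + 1 / β)
    (hαC : α * C ≤ 1) {t : ℕ → ℕ} (ht : ∀ n : ℕ, t n = ⌊(n : ℝ) ^ α⌋₊) (hmono : Monotone t) :
    ((C * Real.log D.L : ℝ) : EReal) ≤ seqEntropy D.μ D.T t := by
  by_contra! hlt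
  obtain ⟨y, hy1, hy2⟩ := EReal.lt_iff_exists_real_btwn.1 hlt
  rw [EReal.coe_lt_coe_iff] at hy2
  obtain ⟨r, N, hN, hev⟩ := hD.eventually_le_shannonEntropy hα hαC ht hmono hy2
  refine hy1.not_ge ?_
  have hm : Measurable (D.offsetFin r) := measurable_to_countable' (D.measurableSet_offsetFin r)
  refine le_iSup_of_le (D.ht r + D.L) (le_iSup_of_le (D.offsetFin r) (le_iSup_of_le hm ?_))
  refine le_limsup_of_frequently_le ?_ (by isBoundedDefault)
  refine hN.frequently (Eventually.frequently ?_)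
  filter_upwards [hev, hN.eventually_ge_atTop 1] with n hn hn1
  have hN0 : (0 : ℝ) < N n := by exact_mod_cast hn1
  rw [EReal.coe_le_coe_iff, one_div, le_inv_mul_iff₀ hN0]
  exact hn

end Odo

/-- Every value `C * log L` with `0 < C ≤ β / (1 + β)` is the sequence entropy along
`⌊n ^ (1 + 1 / β)⌋` of some rank one system. -/
theorem exists_isRankOneSystem_seqEntropy_eq {L : ℕ} (hL : 2 ≤ L) {α β C : ℝ} (hβ : 0 < β)
    (hα : α = 1 + 1 / β) (hC : 0 < C) (hαC : α * C ≤ 1) {t : ℕ → ℕ}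
    (ht : ∀ n : ℕ, t n = ⌊(n : ℝ) ^ α⌋₊) :
    ∃ (X : Type) (_ : MeasurableSpace X) (μ : Measure X) (T : X ≃ᵐ X),
      IsRankOneSystem μ T ∧ seqEntropy μ T t = ((C * Real.log L : ℝ) : EReal) := by
  obtain ⟨D, rfl, hD⟩ := exists_hasRate hL hβ hC
  have hα0 : 0 ≤ α := by rw [hα]; positivity
  have hmono : Monotone t := by
    intro a b hab
    rw [ht, ht]
    exact Nat.floor_mono (Real.rpow_le_rpow (Nat.cast_nonneg _) (by exact_mod_cast hab) hα0)
  exact ⟨D.Space, inferInstance, D.μ, D.T, D.isRankOneSystem,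
    le_antisymm (hD.seqEntropy_le hα ht hmono) (hD.le_seqEntropy hα hαC ht hmono)⟩

/-- The left side is below both `1` and `2 * β`. The right side is at least `1` if `2 * β ≥ 1`, and
at least `2 * β` otherwise, the exponent being at most `1`. -/
theorem div_one_add_le_rpow {β : ℝ} (hβ : 0 < β) :
    β / (1 + β) ≤ (2 * β) ^ (1 / (1 + β)) := by
  have h1 : β / (1 + β) ≤ 1 := by rw [div_le_one (by positivity)]; linarith
  have h2 : β / (1 + β) ≤ β := div_le_self hβ.le (by linarith)
  have h3 : 1 / (1 + β) ≤ 1 := by rw [div_le_one (by positivity)]; linarith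
  rcases le_total 1 (2 * β) with h | h
  · exact h1.trans (Real.one_le_rpow h (by positivity))
  · calc β / (1 + β) ≤ 2 * β := by linarith
      _ = (2 * β) ^ (1 : ℝ) := (Real.rpow_one _).symm
      _ ≤ _ := Real.rpow_le_rpow_of_exponent_ge (by positivity) h h3

end SeqEnt

end

theorem mainTheorem5 (β : ℝ) (hβ : 0 < β) (α : ℝ) (hα : α = 1 + 1 / β)
    (t : ℕ → ℕ) (ht : ∀ n : ℕ, t n = ⌊(n : ℝ) ^ α⌋₊) :
    (∀ m : ℝ, 0 < m →
      ∃ (X : Type) (_ : MeasurableSpace X) (μ : Measure X) (T : X ≃ᵐ X),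
        SeqEnt.IsRankOneSystem μ T ∧
        0 < SeqEnt.seqEntropy μ T t ∧ SeqEnt.seqEntropy μ T t < (m : EReal)) ∧
    (∀ L : ℕ, 2 ≤ L →
      ∃ (X : Type) (_ : MeasurableSpace X) (μ : Measure X) (T : X ≃ᵐ X),
        SeqEnt.IsRankOneSystem μ T ∧
        ((β / (1 + β) * Real.log L : ℝ) : EReal) ≤ SeqEnt.seqEntropy μ T t ∧
        SeqEnt.seqEntropy μ T t ≤ (((2 * β) ^ (1 / (1 + β)) * Real.log L : ℝ) : EReal)) := by
  have hα0 : 0 < α := by rw [hα]; positivity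
  have hαC : α * (β / (1 + β)) = 1 := by rw [hα]; field_simp; ring
  constructor
  · intro m hm
    have hlog : 0 < Real.log (2 : ℕ) := Real.log_pos (by norm_num)
    -- With `L = 2` the entropy is `C * log 2`; the second term makes it at most `m / 2`, the first
    -- keeps `α * C ≤ 1`.
    have hC : 0 < min (β / (1 + β)) (m / (2 * Real.log (2 : ℕ))) := by positivity
    obtain ⟨X, mX, μ, T, h1, h2⟩ := SeqEnt.exists_isRankOneSystem_seqEntropy_eq le_rfl hβ hα hC
      ((mul_le_mul_of_nonneg_left (min_le_left _ _) hα0.le).trans hαC.le) ht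
    refine ⟨X, mX, μ, T, h1, ?_, ?_⟩
    · rw [h2]
      exact_mod_cast mul_pos hC hlog
    · rw [h2, EReal.coe_lt_coe_iff]
      calc _ ≤ m / (2 * Real.log (2 : ℕ)) * Real.log (2 : ℕ) :=
            mul_le_mul_of_nonneg_right (min_le_right _ _) hlog.le
        _ = m / 2 := by field_simp
        _ < m := half_lt_self hm
  · intro L hL
    have hC : 0 < β / (1 + β) := by positivity
    obtain ⟨X, mX, μ, T, h1, h2⟩ :=
      SeqEnt.exists_isRankOneSystem_seqEntropy_eq hL hβ hα hC hαC.le ht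
    refine ⟨X, mX, μ, T, h1, h2.ge, ?_⟩
    rw [h2, EReal.coe_le_coe_iff]
    exact mul_le_mul_of_nonneg_right (SeqEnt.div_one_add_le_rpow hβ) (Real.log_natCast_nonneg L)
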